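/- **Setting.** Let $N\ge 2$, $d\ge 1$, and let $f_1,\dots,f_N:\mathbb R^d\to\mathbb R$ be $\mu$-strongly convex ($\mu>0$) and $L$-smooth (differentiable with $L$-Lipschitz gradient). Let $w^*=\arg\min_{w\in\mathbb R^d}\frac1N\sum_i f_i(w)$, let $\mathcal W\subset\mathbb R^d$ be closed, convex and bounded with $w^*\in\mathrm{int}(\mathcal W)$, let $\zeta>0$ be the distance of $w^*$ to the boundary of $\mathcal W$, $\mathrm{dm}(\mathcal W)$ the diameter of $\mathcal W$, and $\nabla^*=\max_i\|\nabla f_i(w^*)\|$. Let $\boldsymbol L=(\ell_{ij})\in\mathbb R^{N\times N}$ be a Laplacian matrix (symmetric, $\ell_{ij}\le 0$ for $i\ne j$, zero row sums) with eigenvalues $0=\rho_1\le\rho_2\le\dots\le\rho_N$ and $\rho_2>0$; put $\hat{\boldsymbol L}=\boldsymbol L\otimes I_d$. For $W=(w_1,\dots,w_N)\in\mathbb R^{Nd}$ let $f(W)=\sum_i f_i(w_i)$, let $\Pi^N$ be the Euclidean projection onto $\mathcal W^N$, and $W^*=(w^*,\dots,w^*)$. Write $\|a\|_{\mathbb E}=\sqrt{\mathbb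 E\|a\|^2}$ for a random vector $a$. **Iterates.** Let $(\mathcal F_k)_{k\ge0}$ be a filtration. Starting from an $\mathcal F_0$-measurable $W_0\in\mathcal W^N$, let $$W_{k+1}=\Pi^N[W_k+\gamma_k\tilde D_k-\eta_k G_k],$$ where $W_k=(w_{1k},\dots,w_{Nk})$ is $\mathcal F_k$-measurable, and the noisy disagreement signals $\tilde D_k$ and the stochastic gradients $G_k$ are square integrable with $\mathbb E[\tilde D_k|\mathcal F_k]=-\hat{\boldsymbol L}W_k$, $\mathbb E[G_k|\mathcal F_k]=\nabla f(W_k)$, $\frac1N\mathbb E[\|\tilde D_k-\mathbb E[\tilde D_k|\mathcal F_k]\|^2|\mathcal F_k]\le\Sigma^{(1)}$ and $\frac1N\mathbb E[\|G_k-\nabla f(W_k)\|^2|\mathcal F_k]\le\Sigma^{(2)}$ for constants $\Sigma^{(1)},\Sigma^{(2)}\ge0$. The stepsizes are $$\gamma_k=\gamma_0(1+\delta k)^{-3/4},\qquad \eta_k=\eta_0(1+\delta k)^{-1},\qquad \gamma_0,\eta_0>0,\quad 0<\delta\le\tfrac45\mu\eta_0 .$$ Let $G_k(W)=f(W)+\frac{\gamma_k}{2\eta_k}W^\top\hat{\boldsymbol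 L}W$ denote the Lyapunov function (as a function of $W$, not to be confused with the random vector $G_k$) and $W_k^*=\arg\min_{W\in\mathcal W^N}G_k(W)$. Call $\bar\kappa\ge0$ admissible if for all $k\ge\bar\kappa$ $$\eta_k(\mu+L)+\gamma_k\rho_N\le 2\qquad\text{and}\qquad \eta_k\sqrt N\,\nabla^*L\le\gamma_k\,\zeta\mu\rho_2 ,$$ and for such $\bar\kappa$ let $\overline W_{\bar\kappa}=W_{\bar\kappa}$, $\overline W_{k+1}=\Pi^N[\overline W_k-\eta_k\nabla G_k(\overline W_k)]$ for $k\ge\bar\kappa$ be the noise-free dynamics. **Theorem 2.** An admissible $\bar\kappa$ exists. For every admissible $\bar\kappa$ and all $k\ge\bar\kappa$, $$\frac1{\sqrt N}\|W_k-\overline W_k\|_{\mathbb E}\le\frac{\sqrt5\,e}{2\sqrt\mu}\Big[\frac{\gamma_0}{\sqrt{\eta_0}}\sqrt{\Sigma^{(1)}}+\sqrt{\eta_0\Sigma^{(2)}}(1+\delta k)^{-1/4}\Big](1+\delta k)^{-1/4},$$ $$\frac1{\sqrt N}\|\overline W_k-W_k^*\|_{\mathbb E}\le\mathrm{dm}(\mathcal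 W)\Big(1+\frac{\delta(k-\bar\kappa)}{1+\delta\bar\kappa}\Big)^{-5/4}+\frac{\nabla^*L}{\mu\rho_2}\frac e4\frac{\eta_0}{\gamma_0}\Big(1+\frac{L^2}{\mu\rho_2}\frac{\eta_0}{\gamma_0}(1+\delta k)^{-1/4}\Big)(1+\delta k)^{-1/4},$$ $$\frac1{\sqrt N}\|W_k^*-W^*\|\le\frac{\nabla^*L}{\mu\rho_2}\frac{\eta_0}{\gamma_0}(1+\delta k)^{-1/4}.$$ Consequently $\mathbb E\big[\frac1N\sum_i\|w_{ik}-w^*\|^2\big]=\mathcal O(1/\sqrt k)$ as $k\to\infty$. -/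

import Mathlib

open MeasureTheory Filter Topology
open scoped BigOperators Gradient

noncomputable section

namespace NoisyDGD

/-- The parameter space `ℝ^d` with the Euclidean norm. -/
abbrev Vec (d : ℕ) : Type := EuclideanSpace ℝ (Fin d)

/-- The stacked space `ℝ^{Nd}`: a network state `(w_1, …, w_N)` with the Euclidean norm. -/
abbrev Stack (N d : ℕ) : Type := PiLp 2 (fun _ : Fin N => Vec d)

/-- A minimizer of `g` over `S` (an arbitrary point if there is none). -/
def argminOn {E : Type*} [Nonempty E] (g : E → ℝ) (S : Set E) : E :=
  Classical.epsilon (fun x => x ∈ S ∧ IsMinOn g S x)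

/-- If `g` has a minimizer over `S`, then `argminOn g S` is one. -/
theorem argminOn_spec {E : Type*} [Nonempty E] {g : E → ℝ} {S : Set E}
    (h : ∃ x, x ∈ S ∧ IsMinOn g S x) : argminOn g S ∈ S ∧ IsMinOn g S (argminOn g S) :=
  Classical.epsilon_spec h

/-- Euclidean projection of `a` onto `S`. -/
def proj {E : Type*} [NormedAddCommGroup E] (S : Set E) (a : E) : E :=
  argminOn (fun w => ‖w - a‖) S

/-- `L`-smoothness: differentiable with `L`-Lipschitz gradient. -/
def IsSmooth {d : ℕ} (L : ℝ) (g : Vec d → ℝ) : Prop :=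
  Differentiable ℝ g ∧ ∀ x y, ‖∇ g x - ∇ g y‖ ≤ L * ‖x - y‖

/-- A matrix of Laplacian weights: symmetric, nonpositive off the diagonal, zero row sums. -/
structure IsLaplacian {N : ℕ} (ℓ : Matrix (Fin N) (Fin N) ℝ) : Prop where
  symm : ℓ.IsHermitian
  offDiag_nonpos : ∀ i j, i ≠ j → ℓ i j ≤ 0
  rowSum_zero : ∀ i, ∑ j, ℓ i j = 0

/-- The `m`-th smallest eigenvalue `ρ_m` (`1 ≤ m ≤ N`, with multiplicity) of a symmetric `N × N`
matrix. Mathlib's `eigenvalues₀` lists the eigenvalues in decreasing order, indexed from `0`. -/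
def eig {N : ℕ} {ℓ : Matrix (Fin N) (Fin N) ℝ} (h : ℓ.IsHermitian) (m : ℕ) : ℝ :=
  if hm : 1 ≤ m ∧ m ≤ N then
    h.eigenvalues₀ ⟨N - m, by rw [Fintype.card_fin]; omega⟩
  else 0

/-- The network objective `F(w) = (1/N) ∑ f_i(w)`. -/
def avgObj {N d : ℕ} (f : Fin N → Vec d → ℝ) (w : Vec d) : ℝ :=
  (1 / (N : ℝ)) * ∑ i, f i w

/-- The stacked objective `f(W) = ∑ f_i(w_i)`. -/
def sumObj {N d : ℕ} (f : Fin N → Vec d → ℝ) (W : Stack N d) : ℝ :=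
  ∑ i, f i (W i)

/-- `(ℓ ⊗ I_d) W`. -/
def lapAct {N d : ℕ} (ℓ : Matrix (Fin N) (Fin N) ℝ) (W : Stack N d) : Stack N d :=
  WithLp.toLp 2 (fun i => ∑ j, ℓ i j • W j)

/-- The Lyapunov function `f(W) + (γ / (2η)) Wᵀ (ℓ ⊗ I_d) W`. -/
def lyap {N d : ℕ} (f : Fin N → Vec d → ℝ) (ℓ : Matrix (Fin N) (Fin N) ℝ) (γ η : ℝ)
    (W : Stack N d) : ℝ :=
  sumObj f W + γ / (2 * η) * inner ℝ W (lapAct ℓ W)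

/-- The product set `𝒲^N`. -/
def prodSet {d : ℕ} (N : ℕ) (𝒲 : Set (Vec d)) : Set (Stack N d) :=
  {W | ∀ i, W i ∈ 𝒲}

/-- The consensus state `1_N ⊗ w`. -/
def consensus {d : ℕ} (N : ℕ) (w : Vec d) : Stack N d :=
  WithLp.toLp 2 (fun _ => w)

/-- The minimizer `W_k^*` of the Lyapunov function over `𝒲^N`, for stepsizes `γ`, `η`. -/
def lyapMin {N d : ℕ} (f : Fin N → Vec d → ℝ) (ℓ : Matrix (Fin N) (Fin N) ℝ)
    (𝒲 : Set (Vec d)) (γ η : ℝ) : Stack N d :=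
  argminOn (lyap f ℓ γ η) (prodSet N 𝒲)

/-- The noise-free dynamics: started from `X` at iteration `κ`, then projected gradient descent
on the time-varying Lyapunov function. (For `k < κ` the value is `X` and plays no role.) -/
def noiseFree {N d : ℕ} (f : Fin N → Vec d → ℝ) (ℓ : Matrix (Fin N) (Fin N) ℝ)
    (𝒲 : Set (Vec d)) (γ η : ℕ → ℝ) (κ : ℕ) (X : Stack N d) : ℕ → Stack N d
  | 0 => X
  | k + 1 =>
    if κ ≤ k then
      proj (prodSet N 𝒲) (noiseFree f ℓ 𝒲 γ η κ X k
        - η k • ∇ (lyap f ℓ (γ k) (η k)) (noiseFree f ℓ 𝒲 γ η κ X k))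
    else X

/-- The root mean square norm `‖a‖_𝔼 = √(𝔼[‖a‖²])`. -/
def normE {Ω : Type*} [MeasurableSpace Ω] (P : Measure Ω) {E : Type*} [NormedAddCommGroup E]
    (a : Ω → E) : ℝ :=
  Real.sqrt (∫ ω, ‖a ω‖ ^ 2 ∂P)

/-- The gradient divergence `max_i ‖∇ f_i(w)‖`. -/
def gradDiv {N d : ℕ} (f : Fin N → Vec d → ℝ) (w : Vec d) : ℝ :=
  ⨆ i, ‖∇ (f i) w‖

/-- The stochastic process `W` is generated by projected decentralized gradient descent with
noisy consensus signals `D` and noisy gradients `G`, both unbiased given the past `ℱ k`, whose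
errors have conditional variance (per node) at most `S₁` and `S₂`. -/
structure IsProcess {N d : ℕ} {Ω : Type*} [mΩ : MeasurableSpace Ω] (P : Measure Ω)
    (ℱ : Filtration ℕ mΩ) (f : Fin N → Vec d → ℝ) (ℓ : Matrix (Fin N) (Fin N) ℝ)
    (𝒲 : Set (Vec d)) (γ η : ℕ → ℝ) (S₁ S₂ : ℝ) (W D G : ℕ → Ω → Stack N d) : Prop where
  /-- The local states lie in `𝒲` initially (hence always). -/
  init_mem : ∀ ω, W 0 ω ∈ prodSet N 𝒲
  /-- `ℱ k` contains the information on the states at iteration `k`. -/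
  adapted : ∀ k, StronglyMeasurable[ℱ k] (W k)
  update : ∀ k ω, W (k + 1) ω = proj (prodSet N 𝒲) (W k ω + γ k • D k ω - η k • G k ω)
  memLp_D : ∀ k, MemLp (D k) 2 P
  memLp_G : ∀ k, MemLp (G k) 2 P
  unbiased_D : ∀ k, P[D k | ℱ k] =ᵐ[P] fun ω => -lapAct ℓ (W k ω)
  unbiased_G : ∀ k, P[G k | ℱ k] =ᵐ[P] fun ω => ∇ (sumObj f) (W k ω)
  variance_D : ∀ k, ∀ᵐ ω ∂P,
    (1 / (N : ℝ)) * (P[fun ω' => ‖D k ω' - (P[D k | ℱ k]) ω'‖ ^ 2 | ℱ k]) ω ≤ S₁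
  variance_G : ∀ k, ∀ᵐ ω ∂P,
    (1 / (N : ℝ)) * (P[fun ω' => ‖G k ω' - ∇ (sumObj f) (W k ω')‖ ^ 2 | ℱ k]) ω ≤ S₂

/-- The decreasing consensus stepsize `γ_k = γ₀ (1 + δ k)^{-3/4}`. -/
def consStep (γ₀ δ : ℝ) (k : ℕ) : ℝ := γ₀ * (1 + δ * k) ^ (-(3 / 4) : ℝ)

/-- The decreasing learning stepsize `η_k = η₀ (1 + δ k)^{-1}`. -/
def learnStep (η₀ δ : ℝ) (k : ℕ) : ℝ := η₀ * (1 + δ * k) ^ (-1 : ℝ)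

/-- From iteration `κ` on, the stepsizes satisfy the two smallness conditions
`η_k (μ + L) + γ_k ρ_N ≤ 2` and `η_k / γ_k ≤ ζ μ ρ₂ / (√N ∇* L)`. The second one is written
without denominators, so that it is void (not unsatisfiable) if `∇* = 0`. -/
def SmallSteps (N : ℕ) (μ L ρ₂ ρN ζ gradStar : ℝ) (γ η : ℕ → ℝ) (κ : ℕ) : Prop :=
  ∀ k, κ ≤ k → η k * (μ + L) + γ k * ρN ≤ 2 ∧
    η k * (Real.sqrt N * gradStar * L) ≤ γ k * (ζ * μ * ρ₂)

end NoisyDGD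

end

/-!
The error splits into the deviation of the iterates from the noise-free dynamics, the distance of
the noise-free dynamics from the moving minimizer `W_k^*` of the Lyapunov function
`f(W) + (β_k / 2) Wᵀ (ℓ ⊗ I) W`, `β_k = γ_k / η_k`, and the distance of `W_k^*` from the consensus
state `W^*` at the optimum. The iteration is projected stochastic gradient descent with step `η_k`
on this function, which is `μ`-strongly convex and `(L + β_k ρ_N)`-smooth. The first smallness
condition says `η_k (μ + (L + β_k ρ_N)) ≤ 2`, and cocoercivity of the gradient then makes a gradient
step a contraction with factor `1 - η_k μ` (`norm_gradient_step_sub_le`).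

*Bias and drift.* Both come from one estimate, `norm_le_of_add_lapAct_eq`, for the equation
`z + β ℓ Y = g` with mean-zero `g`, where `z` is the increment of `∇ f` along `Y`. As `z` and `g` are
orthogonal to consensus, testing with `Y` gives first `‖Y_⊥‖ ≤ ‖g‖ / (β ρ₂)` for the disagreement
`Y_⊥` and then `μ ‖Y‖² ≤ ⟨z, Y_⊥⟩ ≤ L ‖Y‖ ‖Y_⊥‖`. With `g = -∇ f(W^*)` this bounds the distance of
the unconstrained minimizer from `W^*`; by the second smallness condition that distance is at most
`ζ`, so the minimizer is feasible and equals `W_k^*` (`Problem.lyapMin_spec`). With `g`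
proportional to `∇ f(W_k^*)` it bounds `W_{k+1}^* - W_k^*`.

*Rates.* The contraction and the drift bound give a scalar recursion for the tracking error
(`tracking_recursion`). For the noise, conditional centring removes the cross term in mean square and
gives a recursion for the variance (`IsProcess.deviation_succ_le`, `noise_recursion`). In both cases
`δ ≤ 4/5 μ η₀` makes the contraction outrun the decay of the claimed bound, which is then verified
by induction on `k`.
-/

namespace NoisyDGD

/-! ### Projections and gradient steps in a Hilbert space -/

section Hilbert

variable {E : Type*} [NormedAddCommGroup E] [InnerProductSpace ℝ E] [CompleteSpace E]

theorem proj_spec {S : Set E} (hne : S.Nonempty) (hcl : IsClosed S) (hco : Convex ℝ S) (a : E) :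
    proj S a ∈ S ∧ ∀ w ∈ S, inner ℝ (a - proj S a) (w - proj S a) ≤ 0 := by
  obtain ⟨v, hv, hmin⟩ := exists_norm_eq_iInf_of_complete_convex hne hcl.isComplete hco a
  have hbdd : BddBelow (Set.range fun w : S => ‖a - w‖) :=
    ⟨0, by rintro _ ⟨w, rfl⟩; exact norm_nonneg _⟩
  have hex : ∃ x, x ∈ S ∧ IsMinOn (fun w => ‖w - a‖) S x := by
    refine ⟨v, hv, fun w hw => ?_⟩
    have := ciInf_le hbdd ⟨w, hw⟩
    simp only [Set.mem_ofPred_eq]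
    rw [norm_sub_rev v, norm_sub_rev w, hmin]
    exact this
  obtain ⟨hp, hpm⟩ := argminOn_spec hex
  refine ⟨hp, (norm_eq_iInf_iff_real_inner_le_zero hco hp).1 ?_⟩
  refine le_antisymm ?_ (ciInf_le hbdd ⟨_, hp⟩)
  rw [← hmin, norm_sub_rev _ (argminOn _ _), norm_sub_rev _ v]
  exact hpm hv

theorem proj_eq_self {S : Set E} (hne : S.Nonempty) (hcl : IsClosed S) (hco : Convex ℝ S) {a : E}
    (ha : a ∈ S) : proj S a = a := by
  have h := (proj_spec hne hcl hco a).2 a ha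
  rw [real_inner_self_eq_norm_sq] at h
  have : ‖a - proj S a‖ = 0 := by nlinarith [norm_nonneg (a - proj S a)]
  exact (sub_eq_zero.1 (norm_eq_zero.1 this)).symm

theorem norm_proj_sub_proj_le {S : Set E} (hne : S.Nonempty) (hcl : IsClosed S) (hco : Convex ℝ S)
    (a b : E) : ‖proj S a - proj S b‖ ≤ ‖a - b‖ := by
  obtain ⟨ha, ha'⟩ := proj_spec hne hcl hco a
  obtain ⟨hb, hb'⟩ := proj_spec hne hcl hco b
  set p := proj S a
  set q := proj S b
  have h1 := ha' q hb
  have h2 := hb' p ha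
  have h3 : ‖p - q‖ ^ 2 ≤ inner ℝ (a - b) (p - q) := by
    have e : inner ℝ (a - b) (p - q) - ‖p - q‖ ^ 2
        = -inner ℝ (a - p) (q - p) - inner ℝ (b - q) (p - q) := by
      rw [← real_inner_self_eq_norm_sq]
      simp only [inner_sub_left, inner_sub_right]
      ring
    linarith
  have h4 := real_inner_le_norm (a - b) (p - q)
  by_contra hlt
  push Not at hlt
  nlinarith [norm_nonneg (p - q), norm_nonneg (a - b)]

theorem hasDerivAt_comp_line {φ : E → ℝ} {A : E → E} (hA : ∀ x, HasGradientAt φ (A x) x)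
    (x v : E) (t : ℝ) : HasDerivAt (fun s : ℝ => φ (x + s • v)) (inner ℝ (A (x + t • v)) v) t := by
  have h1 : HasDerivAt (fun s : ℝ => x + s • v) v t := by
    simpa using ((hasDerivAt_id t).smul_const v).const_add x
  have h2 := (hasGradientAt_iff_hasFDerivAt.1 (hA (x + t • v))).comp_hasDerivAt t h1
  rw [InnerProductSpace.toDual_apply_apply] at h2
  exact h2

/-- Integrated form of strong monotonicity of a gradient. The modulus `m` may be negative, so that
applied to `-φ` the lemma also gives the quadratic upper bound of a smooth function. -/
theorem quadratic_le_of_gradient {φ : E → ℝ} {A : E → E} (hA : ∀ x, HasGradientAt φ (A x) x)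
    {m : ℝ} (hm : ∀ x y, m * ‖x - y‖ ^ 2 ≤ inner ℝ (A x - A y) (x - y)) (x y : E) :
    φ x + inner ℝ (A x) (y - x) + m / 2 * ‖y - x‖ ^ 2 ≤ φ y := by
  set v := y - x
  let q : ℝ → ℝ := fun t => φ (x + t • v) - t * inner ℝ (A x) v - m / 2 * ‖v‖ ^ 2 * t ^ 2
  have hq : ∀ t, HasDerivAt q
      (inner ℝ (A (x + t • v)) v - inner ℝ (A x) v - m * ‖v‖ ^ 2 * t) t := by
    intro t
    have := ((hasDerivAt_comp_line hA x v t).sub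
      ((hasDerivAt_id t).mul_const (inner ℝ (A x) v))).sub
      ((hasDerivAt_pow 2 t).const_mul (m / 2 * ‖v‖ ^ 2))
    refine this.congr_deriv ?_
    simp only [one_mul, Nat.cast_ofNat, Nat.add_one_sub_one, pow_one]
    ring
  have hmono : MonotoneOn q (Set.Icc 0 1) := by
    refine monotoneOn_of_deriv_nonneg (convex_Icc 0 1)
      (fun t _ => (hq t).continuousAt.continuousWithinAt)
      (fun t _ => (hq t).differentiableAt.differentiableWithinAt) ?_
    intro t ht
    rw [interior_Icc] at ht
    rw [(hq t).deriv]
    have h := hm (x + t • v) x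
    rw [add_sub_cancel_left, inner_smul_right, norm_smul, Real.norm_of_nonneg ht.1.le,
      inner_sub_left] at h
    have ht0 := ht.1
    have : 0 ≤ t * (inner ℝ (A (x + t • v)) v - inner ℝ (A x) v - m * ‖v‖ ^ 2 * t) := by
      nlinarith
    exact nonneg_of_mul_nonneg_right this ht0
  have h01 := hmono (Set.left_mem_Icc.2 zero_le_one) (Set.right_mem_Icc.2 zero_le_one) zero_le_one
  simp only [q, zero_smul, add_zero, one_smul] at h01
  have e : x + v = y := by simp [v]
  rw [e] at h01
  linarith

/-- The quadratic upper bound ("descent lemma") of a function whose gradient grows at most at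
rate `K` along every direction. -/
theorem le_quadratic_of_gradient {φ : E → ℝ} {A : E → E} (hA : ∀ x, HasGradientAt φ (A x) x)
    {K : ℝ} (hK : ∀ x y, inner ℝ (A x - A y) (x - y) ≤ K * ‖x - y‖ ^ 2) (x y : E) :
    φ y ≤ φ x + inner ℝ (A x) (y - x) + K / 2 * ‖y - x‖ ^ 2 := by
  have hA' : ∀ x, HasGradientAt (fun z => -φ z) (-A x) x := by
    intro z
    rw [hasGradientAt_iff_hasFDerivAt, map_neg]
    exact (hasGradientAt_iff_hasFDerivAt.1 (hA z)).neg
  have := quadratic_le_of_gradient (m := -K) hA' (fun x y => by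
    have := hK x y
    have e : -A x - -A y = -(A x - A y) := by abel
    rw [e, inner_neg_left]
    linarith) x y
  rw [inner_neg_left] at this
  linarith

/-- Baillon–Haddad: a gradient that is monotone and grows at most at rate `K` is cocoercive. -/
theorem cocoercive_of_gradient {φ : E → ℝ} {A : E → E} (hA : ∀ x, HasGradientAt φ (A x) x)
    {K : ℝ} (hKpos : 0 < K) (h0 : ∀ x y, 0 ≤ inner ℝ (A x - A y) (x - y))
    (hK : ∀ x y, inner ℝ (A x - A y) (x - y) ≤ K * ‖x - y‖ ^ 2) (x y : E) :
    ‖A x - A y‖ ^ 2 ≤ K * inner ℝ (A x - A y) (x - y) := by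
  -- compare `φ` at `x` with `φ` at the gradient step of length `1 / K` taken from `y`
  have key : ∀ x y, φ x + inner ℝ (A x) (y - x) + 1 / (2 * K) * ‖A y - A x‖ ^ 2 ≤ φ y := by
    intro x y
    set B := A y - A x with hB
    set z := y - (1 / K) • B with hz
    have h1 := quadratic_le_of_gradient (m := 0) hA (by simpa using h0) x z
    have h2 := le_quadratic_of_gradient hA hK y z
    have e1 : z - y = -((1 / K) • B) := by simp [hz]
    have e2 : z - x = (y - x) - (1 / K) • B := by rw [hz]; abel
    rw [e1, inner_neg_right, inner_smul_right, norm_neg, norm_smul, Real.norm_of_nonneg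
      (by positivity)] at h2
    rw [e2, inner_sub_right, inner_smul_right] at h1
    have e3 : inner ℝ (A y) B - inner ℝ (A x) B = ‖B‖ ^ 2 := by
      rw [← inner_sub_left, ← hB, real_inner_self_eq_norm_sq]
    have e4 : K / 2 * (1 / K * ‖B‖) ^ 2 = 1 / (2 * K) * ‖B‖ ^ 2 := by field_simp
    have e5 : 1 / K * inner ℝ (A y) B - 1 / K * inner ℝ (A x) B = 2 * (1 / (2 * K) * ‖B‖ ^ 2) := by
      rw [← mul_sub, e3]; field_simp
    linarith
  have h1 := key x y
  have h2 := key y x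
  have e : inner ℝ (A x) (y - x) + inner ℝ (A y) (x - y) = -inner ℝ (A x - A y) (x - y) := by
    rw [inner_sub_left, ← neg_sub x y, inner_neg_right]; ring
  rw [norm_sub_rev (A y)] at h1
  have h3 : 1 / (2 * K) * ‖A x - A y‖ ^ 2 = ‖A x - A y‖ ^ 2 / K / 2 := by field_simp
  have h4 : ‖A x - A y‖ ^ 2 / K ≤ inner ℝ (A x - A y) (x - y) := by linarith
  rw [div_le_iff₀ hKpos] at h4
  linarith

theorem _root_.HasGradientAt.sub_sq {φ : E → ℝ} {g z : E} (h : HasGradientAt φ g z) (m : ℝ) :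
    HasGradientAt (fun z => φ z - m / 2 * ‖z‖ ^ 2) (g - m • z) z := by
  rw [hasGradientAt_iff_hasFDerivAt]
  refine ((hasGradientAt_iff_hasFDerivAt.1 h).sub
    ((hasStrictFDerivAt_norm_sq z).hasFDerivAt.const_mul (m / 2))).congr_fderiv ?_
  ext w
  simp
  ring

/-- A gradient step on an `m`-strongly convex, `K`-smooth function contracts distances by the
factor `1 - η m`, as long as `η (m + K) ≤ 2`. -/
theorem norm_gradient_step_sub_le {φ : E → ℝ} {A : E → E} (hA : ∀ x, HasGradientAt φ (A x) x)
    {m K η : ℝ} (hmK : m < K) (hm : ∀ x y, m * ‖x - y‖ ^ 2 ≤ inner ℝ (A x - A y) (x - y))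
    (hK : ∀ x y, inner ℝ (A x - A y) (x - y) ≤ K * ‖x - y‖ ^ 2) (hη : 0 ≤ η)
    (hstep : η * (m + K) ≤ 2) (x y : E) :
    ‖(x - η • A x) - (y - η • A y)‖ ≤ (1 - η * m) * ‖x - y‖ := by
  have hηm : 0 ≤ 1 - η * m := by
    have : η * m ≤ η * K := by gcongr
    linarith
  -- the gradient of `φ - m/2 ‖·‖²` is cocoercive
  have hA' := fun z => (hA z).sub_sq m
  have hdiff : ∀ x y, (A x - m • x) - (A y - m • y) = (A x - A y) - m • (x - y) := by
    intro x y; rw [smul_sub]; abel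
  have hin : ∀ x y, inner ℝ ((A x - m • x) - (A y - m • y)) (x - y)
      = inner ℝ (A x - A y) (x - y) - m * ‖x - y‖ ^ 2 := by
    intro x y
    rw [hdiff, inner_sub_left, real_inner_smul_left, real_inner_self_eq_norm_sq]
  have hco := cocoercive_of_gradient (K := K - m) hA' (by linarith)
    (fun x y => by rw [hin]; linarith [hm x y])
    (fun x y => by rw [hin]; linarith [hK x y]) x y
  have h0 : 0 ≤ inner ℝ ((A x - m • x) - (A y - m • y)) (x - y) := by
    rw [hin]; linarith [hm x y]
  set B := (A x - m • x) - (A y - m • y) with hB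
  have e : (x - η • A x) - (y - η • A y) = (1 - η * m) • (x - y) - η • B := by
    rw [hB]; module
  rw [e]
  refine abs_le_of_sq_le_sq' ?_ (by positivity) |>.2
  rw [norm_sub_sq_real, norm_smul, norm_smul, inner_smul_left, inner_smul_right,
    real_inner_comm, Real.norm_of_nonneg hηm, Real.norm_of_nonneg hη]
  simp only [conj_trivial]
  rw [mul_pow, mul_pow]
  have h1 : η ^ 2 * ‖B‖ ^ 2 ≤ η ^ 2 * ((K - m) * inner ℝ B (x - y)) := by gcongr
  have h2 : η * (η * (K - m)) * inner ℝ B (x - y) ≤ η * (2 * (1 - η * m)) * inner ℝ B (x - y) := by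
    refine mul_le_mul_of_nonneg_right (mul_le_mul_of_nonneg_left ?_ hη) h0
    linarith
  rw [real_inner_comm] at h1 h2 ⊢
  nlinarith

/-- A strongly monotone gradient of bounded growth has a zero: it is the fixed point of a
contractive gradient step. -/
theorem exists_gradient_eq_zero {φ : E → ℝ} {A : E → E} (hA : ∀ x, HasGradientAt φ (A x) x)
    {m K : ℝ} (hm0 : 0 < m) (hmK : m < K)
    (hm : ∀ x y, m * ‖x - y‖ ^ 2 ≤ inner ℝ (A x - A y) (x - y))
    (hK : ∀ x y, inner ℝ (A x - A y) (x - y) ≤ K * ‖x - y‖ ^ 2) : ∃ x, A x = 0 := by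
  have hs : 0 < m + K := by linarith
  set η := 1 / (m + K) with hη
  have hη0 : 0 < η := by positivity
  have hηe : η * (m + K) = 1 := by rw [hη]; field_simp
  have h := norm_gradient_step_sub_le (η := η) hA hmK hm hK hη0.le (by linarith)
  have hc0 : 0 ≤ 1 - η * m := by nlinarith
  have hc : ContractingWith (1 - η * m).toNNReal (fun x => x - η • A x) := by
    refine ⟨?_, LipschitzWith.of_dist_le_mul fun x y => ?_⟩
    · rw [Real.toNNReal_lt_one]
      nlinarith
    · rw [dist_eq_norm, dist_eq_norm, Real.coe_toNNReal _ hc0]; exact h x y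
  refine ⟨hc.fixedPoint _, ?_⟩
  have hf := hc.fixedPoint_isFixedPt
  simp only [Function.IsFixedPt, sub_eq_self, smul_eq_zero] at hf
  exact hf.resolve_left hη0.ne'

/-- The gradient of a strongly convex function is strongly monotone. -/
theorem strongMono_of_strongConvexOn {φ : E → ℝ} {A : E → E} (hA : ∀ x, HasGradientAt φ (A x) x)
    {m : ℝ} (hφ : StrongConvexOn Set.univ m φ) (x y : E) :
    m * ‖x - y‖ ^ 2 ≤ inner ℝ (A x - A y) (x - y) := by
  rw [strongConvexOn_iff_convex] at hφ
  have hA' := fun z => (hA z).sub_sq m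
  have hline : ConvexOn ℝ Set.univ
      (fun t : ℝ => (fun z => φ z - m / 2 * ‖z‖ ^ 2) (y + t • (x - y))) := by
    have := hφ.comp_affineMap (AffineMap.lineMap y x : ℝ →ᵃ[ℝ] E)
    rw [Set.preimage_univ] at this
    refine this.congr fun t _ => ?_
    simp [AffineMap.lineMap_apply, add_comm]
  have h1 := hline.le_slope_of_hasDerivAt (Set.mem_univ 0) (Set.mem_univ 1) zero_lt_one
    (hasDerivAt_comp_line hA' y (x - y) 0)
  have h2 := hline.slope_le_of_hasDerivAt (Set.mem_univ 0) (Set.mem_univ 1) zero_lt_one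
    (hasDerivAt_comp_line hA' y (x - y) 1)
  have h3 := h1.trans h2
  simp only [zero_smul, add_zero, one_smul, add_sub_cancel] at h3
  have e : inner ℝ (x - y) (x - y) = ‖x - y‖ ^ 2 := real_inner_self_eq_norm_sq _
  rw [inner_sub_left, inner_sub_left, real_inner_smul_left, real_inner_smul_left] at h3
  rw [inner_sub_left] at e
  rw [inner_sub_left, ← e]
  linarith

end Hilbert

/-! ### Laplacian spectrum and disagreement -/

section Spectrum

variable {N : ℕ} {ℓ : Matrix (Fin N) (Fin N) ℝ}

theorem dotProduct_mulVec_eq_sum_eigenvalues (h : ℓ.IsHermitian) (x : Fin N → ℝ) :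
    ∑ i, x i * ∑ j, ℓ i j * x j
      = ∑ m, h.eigenvalues m * (inner ℝ (h.eigenvectorBasis m) (WithLp.toLp 2 x)) ^ 2 := by
  set b := h.eigenvectorBasis
  have h1 : ∑ i, x i * ∑ j, ℓ i j * x j
      = inner ℝ (WithLp.toLp 2 x : EuclideanSpace ℝ (Fin N)) (WithLp.toLp 2 (ℓ.mulVec x)) := by
    simp [PiLp.inner_apply, Matrix.mulVec, dotProduct, mul_comm]
  rw [h1, ← b.sum_inner_mul_inner]
  refine Finset.sum_congr rfl fun m _ => ?_
  have h2 : inner ℝ (b m) (WithLp.toLp 2 (ℓ.mulVec x))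
      = h.eigenvalues m * inner ℝ (b m) (WithLp.toLp 2 x) := by
    have e := h.mulVec_eigenvectorBasis m
    have hs : ℓ.transpose = ℓ := by simpa [Matrix.IsHermitian] using h
    have : inner ℝ (b m) (WithLp.toLp 2 (ℓ.mulVec x))
        = dotProduct (b m : Fin N → ℝ) (ℓ.mulVec x) := by
      simp [PiLp.inner_apply, dotProduct, mul_comm]
    rw [this, Matrix.dotProduct_mulVec, ← Matrix.mulVec_transpose, hs]
    change dotProduct (ℓ.mulVec (h.eigenvectorBasis m).ofLp) x = _
    rw [e]
    simp [PiLp.inner_apply, dotProduct, mul_comm, b, Finset.mul_sum]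
    refine Finset.sum_congr rfl fun i _ => by ring
  rw [h2, real_inner_comm]
  ring

theorem sum_eigenvectorBasis_sq (h : ℓ.IsHermitian) (x : Fin N → ℝ) :
    ∑ m, (inner ℝ (h.eigenvectorBasis m) (WithLp.toLp 2 x)) ^ 2 = ∑ i, x i ^ 2 := by
  have := h.eigenvectorBasis.sum_sq_norm_inner_right (WithLp.toLp 2 x)
  simp only [Real.norm_eq_abs, sq_abs] at this
  rw [this, EuclideanSpace.norm_sq_eq]
  simp

theorem eigenvalues_le_eig (hN : 2 ≤ N) (h : ℓ.IsHermitian) (m : Fin N) :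
    h.eigenvalues m ≤ eig h N := by
  rw [eig, dif_pos ⟨by omega, le_refl N⟩, Matrix.IsHermitian.eigenvalues]
  exact h.eigenvalues₀_antitone (by simp [Fin.le_def])

theorem exists_forall_eig_two_le (hN : 2 ≤ N) (h : ℓ.IsHermitian) :
    ∃ m₀ : Fin N, ∀ m, m ≠ m₀ → eig h 2 ≤ h.eigenvalues m := by
  have hlast : N - 1 < Fintype.card (Fin N) := by rw [Fintype.card_fin]; omega
  set e := (Fintype.equivOfCardEq (Fintype.card_fin _) : Fin (Fintype.card (Fin N)) ≃ Fin N)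
  refine ⟨e ⟨N - 1, hlast⟩, fun m hm => ?_⟩
  rw [eig, dif_pos ⟨by omega, hN⟩, Matrix.IsHermitian.eigenvalues]
  refine h.eigenvalues₀_antitone ?_
  have h1 : e.symm m ≠ ⟨N - 1, hlast⟩ := fun hh => hm (by rw [← hh]; simp)
  have h2 : (e.symm m : ℕ) < N := (e.symm m).2.trans_eq (Fintype.card_fin N)
  rw [Fin.le_def]
  have h3 : (e.symm m : ℕ) ≠ N - 1 := fun hh => h1 (Fin.ext hh)
  change (e.symm m : ℕ) ≤ N - 2
  omega

theorem eig_two_le_eig (hN : 2 ≤ N) (h : ℓ.IsHermitian) : eig h 2 ≤ eig h N := by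
  rw [eig, eig, dif_pos ⟨by omega, hN⟩, dif_pos ⟨by omega, le_refl N⟩]
  exact h.eigenvalues₀_antitone (by simp [Fin.le_def])

theorem quadForm_le (hN : 2 ≤ N) (h : ℓ.IsHermitian) (x : Fin N → ℝ) :
    ∑ i, x i * ∑ j, ℓ i j * x j ≤ eig h N * ∑ i, x i ^ 2 := by
  rw [dotProduct_mulVec_eq_sum_eigenvalues h, ← sum_eigenvectorBasis_sq h, Finset.mul_sum]
  gcongr with m
  exact eigenvalues_le_eig hN h m

/-- On mean-zero vectors the quadratic form of a Laplacian is bounded below by its second smallest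
eigenvalue. As this is positive, all eigenvectors but the last are orthogonal to the constants, so
the last one spans them. -/
theorem le_quadForm (hN : 2 ≤ N) (hℓ : IsLaplacian ℓ) (hconn : 0 < eig hℓ.symm 2)
    {x : Fin N → ℝ} (hx : ∑ i, x i = 0) :
    eig hℓ.symm 2 * ∑ i, x i ^ 2 ≤ ∑ i, x i * ∑ j, ℓ i j * x j := by
  obtain ⟨m₀, hm₀⟩ := exists_forall_eig_two_le hN hℓ.symm
  have hs := hℓ.symm
  set b := hs.eigenvectorBasis
  set o : EuclideanSpace ℝ (Fin N) := WithLp.toLp 2 (fun _ => 1)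
  have ho : ∀ m, m ≠ m₀ → inner ℝ (b m) o = 0 := by
    intro m hm
    have hpos : 0 < hs.eigenvalues m := hconn.trans_le (hm₀ m hm)
    have e := hs.mulVec_eigenvectorBasis m
    have hcol : ∀ j, ∑ i, ℓ i j = 0 := fun j => by
      rw [← hℓ.rowSum_zero j]
      exact Finset.sum_congr rfl fun i _ => by simpa using hs.apply j i
    have h1 : ∑ i, (ℓ.mulVec (b m).ofLp) i = 0 := by
      simp only [Matrix.mulVec, dotProduct]
      rw [Finset.sum_comm]
      refine Finset.sum_eq_zero fun j _ => ?_
      rw [← Finset.sum_mul, hcol, zero_mul]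
    rw [e] at h1
    simp only [Pi.smul_apply, smul_eq_mul, ← Finset.mul_sum] at h1
    have h2 := (mul_eq_zero.1 h1).resolve_left hpos.ne'
    simpa [PiLp.inner_apply, o] using h2
  have hrep : (inner ℝ (b m₀) o : ℝ) • b m₀ = o := by
    conv_rhs => rw [← b.sum_repr' o]
    rw [Finset.sum_eq_single m₀ (fun m _ hm => by rw [ho m hm, zero_smul]) (by simp)]
  have ho0 : o ≠ 0 := fun h0 => by
    have := congrArg (fun v : EuclideanSpace ℝ (Fin N) => v ⟨0, by omega⟩) h0
    simp [o] at this
  have hc : (inner ℝ (b m₀) o : ℝ) ≠ 0 := fun h0 => ho0 (by rw [← hrep, h0, zero_smul])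
  have hxo : inner ℝ o (WithLp.toLp 2 x) = (0 : ℝ) := by
    simpa [PiLp.inner_apply, o] using hx
  have hx0 : inner ℝ (b m₀) (WithLp.toLp 2 x) = (0 : ℝ) := by
    rw [← hrep, real_inner_smul_left] at hxo
    exact (mul_eq_zero.1 hxo).resolve_left hc
  rw [dotProduct_mulVec_eq_sum_eigenvalues hs, ← sum_eigenvectorBasis_sq hs, Finset.mul_sum]
  refine Finset.sum_le_sum fun m _ => ?_
  by_cases hm : m = m₀
  · rw [hm, hx0]; simp
  · exact mul_le_mul_of_nonneg_right (hm₀ m hm) (sq_nonneg _)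

end Spectrum

section Stack

variable {N d : ℕ}

theorem inner_stack (X Y : Stack N d) : inner ℝ X Y = ∑ i, inner ℝ (X i) (Y i) :=
  PiLp.inner_apply X Y

theorem norm_sq_stack (X : Stack N d) : ‖X‖ ^ 2 = ∑ i, ‖X i‖ ^ 2 :=
  PiLp.norm_sq_eq_of_L2 _ X

theorem norm_apply_le (X : Stack N d) (i : Fin N) : ‖X i‖ ≤ ‖X‖ := by
  refine abs_le_of_sq_le_sq' ?_ (norm_nonneg _) |>.2
  rw [norm_sq_stack]
  exact Finset.single_le_sum (f := fun i => ‖X i‖ ^ 2) (fun i _ => by positivity)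
    (Finset.mem_univ i)

@[simp] theorem lapAct_apply (ℓ : Matrix (Fin N) (Fin N) ℝ) (X : Stack N d) (i : Fin N) :
    lapAct ℓ X i = ∑ j, ℓ i j • X j := rfl

@[simp] theorem consensus_apply (w : Vec d) (i : Fin N) : consensus N w i = w := rfl

theorem lapAct_add (ℓ : Matrix (Fin N) (Fin N) ℝ) (X Y : Stack N d) :
    lapAct ℓ (X + Y) = lapAct ℓ X + lapAct ℓ Y := by
  ext1 i
  simp [Finset.sum_add_distrib]

theorem lapAct_smul (ℓ : Matrix (Fin N) (Fin N) ℝ) (c : ℝ) (X : Stack N d) :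
    lapAct ℓ (c • X) = c • lapAct ℓ X := by
  ext1 i
  simp [Finset.smul_sum, smul_comm c]

theorem continuous_lapAct (ℓ : Matrix (Fin N) (Fin N) ℝ) :
    Continuous (lapAct ℓ : Stack N d → Stack N d) := by
  refine (PiLp.continuous_toLp 2 _).comp (continuous_pi fun i => ?_)
  exact continuous_finsetSum _ fun j _ => (PiLp.continuous_apply 2 _ j).const_smul (ℓ i j)

/-- `lapAct` as a continuous linear map. -/
noncomputable def lapCLM (ℓ : Matrix (Fin N) (Fin N) ℝ) : Stack N d →L[ℝ] Stack N d :=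
  ⟨IsLinearMap.mk' (lapAct ℓ) ⟨lapAct_add ℓ, lapAct_smul ℓ⟩, continuous_lapAct ℓ⟩

@[simp] theorem lapCLM_apply (ℓ : Matrix (Fin N) (Fin N) ℝ) (X : Stack N d) :
    lapCLM ℓ X = lapAct ℓ X := rfl

theorem lapAct_sub (ℓ : Matrix (Fin N) (Fin N) ℝ) (X Y : Stack N d) :
    lapAct ℓ (X - Y) = lapAct ℓ X - lapAct ℓ Y := map_sub (lapCLM ℓ) X Y

theorem lapAct_consensus {ℓ : Matrix (Fin N) (Fin N) ℝ} (hℓ : IsLaplacian ℓ) (w : Vec d) :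
    lapAct ℓ (consensus N w) = 0 := by
  ext1 i
  simp [← Finset.sum_smul, hℓ.rowSum_zero]

theorem inner_lapAct_symm {ℓ : Matrix (Fin N) (Fin N) ℝ} (h : ℓ.IsHermitian) (X Y : Stack N d) :
    inner ℝ X (lapAct ℓ Y) = inner ℝ (lapAct ℓ X) Y := by
  simp only [inner_stack, lapAct_apply, inner_sum, sum_inner, real_inner_smul_left,
    real_inner_smul_right]
  rw [Finset.sum_comm]
  refine Finset.sum_congr rfl fun i _ => Finset.sum_congr rfl fun j _ => ?_
  rw [show ℓ j i = ℓ i j by simpa using h.apply i j]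

theorem sum_lapAct {ℓ : Matrix (Fin N) (Fin N) ℝ} (hℓ : IsLaplacian ℓ) (X : Stack N d) :
    ∑ i, lapAct ℓ X i = 0 := by
  simp only [lapAct_apply]
  rw [Finset.sum_comm]
  refine Finset.sum_eq_zero fun j _ => ?_
  rw [← Finset.sum_smul]
  have : ∑ i, ℓ i j = 0 := by
    rw [← hℓ.rowSum_zero j]
    exact Finset.sum_congr rfl fun i _ => by simpa using hℓ.symm.apply j i
  rw [this, zero_smul]

theorem inner_lapAct_eq_sum (ℓ : Matrix (Fin N) (Fin N) ℝ) (X : Stack N d) :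
    inner ℝ X (lapAct ℓ X) = ∑ c, ∑ i, X i c * ∑ j, ℓ i j * X j c := by
  rw [Finset.sum_comm, inner_stack]
  refine Finset.sum_congr rfl fun i _ => ?_
  rw [PiLp.inner_apply]
  refine Finset.sum_congr rfl fun c _ => ?_
  simp [mul_comm]

theorem norm_sq_stack_coord (X : Stack N d) : ‖X‖ ^ 2 = ∑ c, ∑ i, X i c ^ 2 := by
  rw [Finset.sum_comm, norm_sq_stack]
  refine Finset.sum_congr rfl fun i _ => ?_
  rw [EuclideanSpace.norm_sq_eq]
  simp

theorem inner_lapAct_le (hN : 2 ≤ N) {ℓ : Matrix (Fin N) (Fin N) ℝ} (h : ℓ.IsHermitian)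
    (X : Stack N d) : inner ℝ X (lapAct ℓ X) ≤ eig h N * ‖X‖ ^ 2 := by
  rw [inner_lapAct_eq_sum, norm_sq_stack_coord, Finset.mul_sum]
  exact Finset.sum_le_sum fun c _ => quadForm_le hN h fun i => X i c

theorem le_inner_lapAct (hN : 2 ≤ N) {ℓ : Matrix (Fin N) (Fin N) ℝ} (hℓ : IsLaplacian ℓ)
    (hconn : 0 < eig hℓ.symm 2) {X : Stack N d} (hX : ∑ i, X i = 0) :
    eig hℓ.symm 2 * ‖X‖ ^ 2 ≤ inner ℝ X (lapAct ℓ X) := by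
  rw [inner_lapAct_eq_sum, norm_sq_stack_coord, Finset.mul_sum]
  refine Finset.sum_le_sum fun c _ => le_quadForm hN hℓ hconn (x := fun i => X i c) ?_
  have := congrArg (fun v : Vec d => v c) hX
  simpa using this

/-- The disagreement component of a network state: its deviation from the average. -/
noncomputable def disagreement (X : Stack N d) : Stack N d :=
  X - consensus N ((1 / (N : ℝ)) • ∑ i, X i)

theorem sum_disagreement (hN : 2 ≤ N) (X : Stack N d) : ∑ i, disagreement X i = 0 := by
  have : (N : ℝ) ≠ 0 := by positivity
  simp only [disagreement, PiLp.sub_apply, consensus_apply, Finset.sum_sub_distrib,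
    Finset.sum_const, Finset.card_univ, Fintype.card_fin]
  rw [← Nat.cast_smul_eq_nsmul ℝ, smul_smul, mul_one_div_cancel this, one_smul, sub_self]

theorem inner_disagreement {g : Stack N d} (hg : ∑ i, g i = 0) (X : Stack N d) :
    inner ℝ g (disagreement X) = inner ℝ g X := by
  rw [disagreement, inner_sub_right, sub_eq_self, inner_stack]
  simp only [consensus_apply, ← sum_inner, hg, inner_zero_left]

theorem inner_lapAct_disagreement {ℓ : Matrix (Fin N) (Fin N) ℝ} (hℓ : IsLaplacian ℓ)
    (X : Stack N d) :
    inner ℝ (disagreement X) (lapAct ℓ (disagreement X)) = inner ℝ X (lapAct ℓ X) := by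
  have h : lapAct ℓ (disagreement X) = lapAct ℓ X := by
    rw [disagreement, lapAct_sub, lapAct_consensus hℓ, sub_zero]
  rw [h, real_inner_comm, inner_disagreement (sum_lapAct hℓ X), real_inner_comm]

theorem inner_lapAct_nonneg (hN : 2 ≤ N) {ℓ : Matrix (Fin N) (Fin N) ℝ} (hℓ : IsLaplacian ℓ)
    (hconn : 0 < eig hℓ.symm 2) (X : Stack N d) : 0 ≤ inner ℝ X (lapAct ℓ X) := by
  rw [← inner_lapAct_disagreement hℓ]
  exact le_trans (by positivity) (le_inner_lapAct hN hℓ hconn (sum_disagreement hN X))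

/-- Sensitivity of the penalized stationarity equation. Let `z` be the increment of a separable
`μ`-strongly monotone, `L`-Lipschitz operator along `Y`. If `z + β ℓ Y = g` and `g` has zero mean,
then `z` has zero mean as well. Testing with `Y`, the right-hand side sees only the disagreement
of `Y`, which the penalty makes of order `‖g‖ / (β ρ₂)`; as `z` is also blind to the mean of `Y`,
`Y` itself is at most `L / μ` times larger than its disagreement. -/
theorem norm_le_of_add_lapAct_eq (hN : 2 ≤ N) {ℓ : Matrix (Fin N) (Fin N) ℝ} (hℓ : IsLaplacian ℓ)
    (hconn : 0 < eig hℓ.symm 2) {μ L β : ℝ} (hμ : 0 < μ) (hL : 0 ≤ L) (hβ : 0 < β)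
    {Y z g : Stack N d} (hzY : μ * ‖Y‖ ^ 2 ≤ inner ℝ z Y) (hz : ‖z‖ ≤ L * ‖Y‖)
    (heq : z + β • lapAct ℓ Y = g) (hg : ∑ i, g i = 0) :
    ‖Y‖ ≤ L / (μ * eig hℓ.symm 2 * β) * ‖g‖ := by
  set ρ := eig hℓ.symm 2
  set V := disagreement Y
  have hzsum : ∑ i, z i = 0 := by
    have e : z = g - β • lapAct ℓ Y := by rw [← heq]; abel
    rw [e]
    simp only [PiLp.sub_apply, PiLp.smul_apply, Finset.sum_sub_distrib, ← Finset.smul_sum,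
      sum_lapAct hℓ, hg, smul_zero, sub_zero]
  have h1 : inner ℝ z Y + β * inner ℝ Y (lapAct ℓ Y) = inner ℝ g V := by
    rw [inner_disagreement hg, ← heq, inner_add_left, real_inner_smul_left,
      real_inner_comm Y (lapAct ℓ Y)]
  have h2 : ρ * ‖V‖ ^ 2 ≤ inner ℝ Y (lapAct ℓ Y) := by
    rw [← inner_lapAct_disagreement hℓ]
    exact le_inner_lapAct hN hℓ hconn (sum_disagreement hN Y)
  have h3 : inner ℝ g V ≤ ‖g‖ * ‖V‖ := real_inner_le_norm _ _
  have h4 : inner ℝ z Y ≤ L * ‖Y‖ * ‖V‖ := by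
    rw [← inner_disagreement hzsum]
    exact (real_inner_le_norm _ _).trans (mul_le_mul_of_nonneg_right hz (norm_nonneg _))
  have h5 : β * ρ * ‖V‖ ≤ ‖g‖ := by
    rcases (norm_nonneg V).eq_or_lt with h | h
    · rw [← h, mul_zero]; exact norm_nonneg _
    · have : β * (ρ * ‖V‖ ^ 2) ≤ β * inner ℝ Y (lapAct ℓ Y) := by gcongr
      have h0 : 0 ≤ μ * ‖Y‖ ^ 2 := by positivity
      refine le_of_mul_le_mul_right ?_ h
      nlinarith
  have h6 : μ * ‖Y‖ ≤ L * ‖V‖ := by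
    rcases (norm_nonneg Y).eq_or_lt with h | h
    · rw [← h, mul_zero]; positivity
    · refine le_of_mul_le_mul_right ?_ h
      nlinarith
  rw [div_mul_eq_mul_div, le_div_iff₀ (by positivity)]
  calc ‖Y‖ * (μ * ρ * β) = μ * ‖Y‖ * (β * ρ) := by ring
    _ ≤ L * ‖V‖ * (β * ρ) := by gcongr
    _ = L * (β * ρ * ‖V‖) := by ring
    _ ≤ L * ‖g‖ := by gcongr

end Stack

/-! ### The penalized objective and its minimizer -/

section Objective

variable {N d : ℕ} {f : Fin N → Vec d → ℝ} {ℓ : Matrix (Fin N) (Fin N) ℝ} {μ L : ℝ}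

/-- The stacked local gradients `(∇ f_1(w_1), …, ∇ f_N(w_N))`. -/
noncomputable def gradStack (f : Fin N → Vec d → ℝ) (W : Stack N d) : Stack N d :=
  WithLp.toLp 2 (fun i => ∇ (f i) (W i))

@[simp] theorem gradStack_apply (W : Stack N d) (i : Fin N) : gradStack f W i = ∇ (f i) (W i) := rfl

theorem hasGradientAt_sumObj (hsmooth : ∀ i, IsSmooth L (f i)) (W : Stack N d) :
    HasGradientAt (sumObj f) (gradStack f W) W := by
  rw [hasGradientAt_iff_hasFDerivAt]
  have h : ∀ i ∈ Finset.univ, HasFDerivAt (fun W : Stack N d => f i (W i))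
      ((InnerProductSpace.toDual ℝ (Vec d) (∇ (f i) (W i))).comp
        (PiLp.proj 2 (fun _ : Fin N => Vec d) i : Stack N d →L[ℝ] Vec d)) W := by
    intro i _
    have h1 := hasGradientAt_iff_hasFDerivAt.1 ((hsmooth i).1 (W i)).hasGradientAt
    exact HasFDerivAt.comp (f := fun W : Stack N d => W i) W h1
      (PiLp.proj 2 (fun _ : Fin N => Vec d) i : Stack N d →L[ℝ] Vec d).hasFDerivAt
  refine (HasFDerivAt.fun_sum h).congr_fderiv ?_
  ext V
  simp [inner_stack]

theorem hasGradientAt_lyap (hsmooth : ∀ i, IsSmooth L (f i)) (hℓ : ℓ.IsHermitian) (γ η : ℝ)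
    (W : Stack N d) :
    HasGradientAt (lyap f ℓ γ η) (gradStack f W + (γ / η) • lapAct ℓ W) W := by
  rw [hasGradientAt_iff_hasFDerivAt]
  have h1 := hasGradientAt_iff_hasFDerivAt.1 (hasGradientAt_sumObj hsmooth W)
  have h2 : HasFDerivAt (fun W : Stack N d => inner ℝ W (lapCLM ℓ W))
      _ W := (hasFDerivAt_id W).inner ℝ (lapCLM ℓ).hasFDerivAt
  refine (h1.add (h2.const_mul (γ / (2 * η)))).congr_fderiv ?_
  ext V
  simp only [map_add, add_apply, smul_apply,
    InnerProductSpace.toDual_apply_apply, ContinuousLinearMap.comp_apply,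
    ContinuousLinearMap.prod_apply, fderivInnerCLM_apply, id_eq, lapCLM_apply,
    real_inner_smul_left, smul_eq_mul, ContinuousLinearMap.id_apply]
  rw [inner_lapAct_symm hℓ W V, real_inner_comm (lapAct ℓ W) V]
  ring

theorem gradStack_strongMono (hconv : ∀ i, StrongConvexOn Set.univ μ (f i))
    (hsmooth : ∀ i, IsSmooth L (f i)) (X Y : Stack N d) :
    μ * ‖X - Y‖ ^ 2 ≤ inner ℝ (gradStack f X - gradStack f Y) (X - Y) := by
  rw [norm_sq_stack, inner_stack, Finset.mul_sum]
  exact Finset.sum_le_sum fun i _ =>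
    strongMono_of_strongConvexOn (fun x => ((hsmooth i).1 x).hasGradientAt) (hconv i) (X i) (Y i)

theorem modulus_le (hN : 2 ≤ N) (hd : 1 ≤ d) (hconv : ∀ i, StrongConvexOn Set.univ μ (f i))
    (hsmooth : ∀ i, IsSmooth L (f i)) : μ ≤ L := by
  let i : Fin N := ⟨0, by omega⟩
  let x : Vec d := EuclideanSpace.single ⟨0, hd⟩ 1
  have hx : ‖x - 0‖ = 1 := by simp [x]
  have h1 := strongMono_of_strongConvexOn (fun x => ((hsmooth i).1 x).hasGradientAt) (hconv i) x 0
  have h2 := real_inner_le_norm (∇ (f i) x - ∇ (f i) 0) (x - 0)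
  have h3 := (hsmooth i).2 x 0
  rw [hx] at h1 h2 h3
  linarith

theorem gradStack_lipschitz (hL : 0 ≤ L) (hsmooth : ∀ i, IsSmooth L (f i)) (X Y : Stack N d) :
    ‖gradStack f X - gradStack f Y‖ ≤ L * ‖X - Y‖ := by
  refine abs_le_of_sq_le_sq' ?_ (by positivity) |>.2
  rw [mul_pow, norm_sq_stack, norm_sq_stack, Finset.mul_sum]
  refine Finset.sum_le_sum fun i _ => ?_
  rw [← mul_pow]
  exact pow_le_pow_left₀ (norm_nonneg _) ((hsmooth i).2 (X i) (Y i)) 2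

theorem continuous_gradStack (hL : 0 ≤ L) (hsmooth : ∀ i, IsSmooth L (f i)) :
    Continuous (gradStack f : Stack N d → Stack N d) :=
  (LipschitzWith.of_dist_le_mul (K := ⟨L, hL⟩) fun X Y => by
    rw [dist_eq_norm, dist_eq_norm]; exact gradStack_lipschitz hL hsmooth X Y).continuous

theorem lyapGrad_sub (β : ℝ) (X Y : Stack N d) :
    (gradStack f X + β • lapAct ℓ X) - (gradStack f Y + β • lapAct ℓ Y)
      = (gradStack f X - gradStack f Y) + β • lapAct ℓ (X - Y) := by
  rw [lapAct_sub, smul_sub]; abel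

theorem lyapGrad_strongMono (hN : 2 ≤ N) (hconv : ∀ i, StrongConvexOn Set.univ μ (f i))
    (hsmooth : ∀ i, IsSmooth L (f i)) (hℓ : IsLaplacian ℓ) (hconn : 0 < eig hℓ.symm 2)
    {β : ℝ} (hβ : 0 < β) (X Y : Stack N d) :
    μ * ‖X - Y‖ ^ 2 ≤ inner ℝ ((gradStack f X + β • lapAct ℓ X)
      - (gradStack f Y + β • lapAct ℓ Y)) (X - Y) := by
  rw [lyapGrad_sub, inner_add_left, real_inner_smul_left, real_inner_comm]
  have h1 := gradStack_strongMono hconv hsmooth X Y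
  have h2 := mul_nonneg hβ.le (inner_lapAct_nonneg hN hℓ hconn (X - Y))
  rw [real_inner_comm] at h1
  rw [real_inner_comm (X - Y) (lapAct _ _)]
  linarith

theorem inner_lyapGrad_le (hN : 2 ≤ N) (hL : 0 ≤ L)
    (hsmooth : ∀ i, IsSmooth L (f i)) (hℓ : ℓ.IsHermitian)
    {β : ℝ} (hβ : 0 < β) (X Y : Stack N d) :
    inner ℝ ((gradStack f X + β • lapAct ℓ X)
      - (gradStack f Y + β • lapAct ℓ Y)) (X - Y) ≤ (L + β * eig hℓ N) * ‖X - Y‖ ^ 2 := by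
  rw [lyapGrad_sub, inner_add_left, real_inner_smul_left]
  have h1 := (real_inner_le_norm (gradStack f X - gradStack f Y) (X - Y)).trans
    (mul_le_mul_of_nonneg_right (gradStack_lipschitz hL hsmooth X Y) (norm_nonneg _))
  have h2 := mul_le_mul_of_nonneg_left (inner_lapAct_le hN hℓ (X - Y)) hβ.le
  rw [real_inner_comm (X - Y) (lapAct _ _)]
  nlinarith

theorem exists_lyapGrad_eq_zero (hN : 2 ≤ N) (hμ : 0 < μ) (hμL : μ ≤ L)
    (hconv : ∀ i, StrongConvexOn Set.univ μ (f i))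
    (hsmooth : ∀ i, IsSmooth L (f i)) (hℓ : IsLaplacian ℓ) (hconn : 0 < eig hℓ.symm 2)
    {β : ℝ} (hβ : 0 < β) : ∃ X : Stack N d, gradStack f X + β • lapAct ℓ X = 0 := by
  have hρ : 0 < eig hℓ.symm N := hconn.trans_le (eig_two_le_eig hN _)
  have hA : ∀ X : Stack N d, HasGradientAt (lyap f ℓ β 1) (gradStack f X + β • lapAct ℓ X) X :=
    fun X => by simpa using hasGradientAt_lyap hsmooth hℓ.symm β 1 X
  exact exists_gradient_eq_zero hA hμ (K := L + β * eig hℓ.symm N)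
    (by nlinarith [mul_pos hβ hρ])
    (lyapGrad_strongMono hN hconv hsmooth hℓ hconn hβ)
    (inner_lyapGrad_le hN (hμ.le.trans hμL) hsmooth hℓ.symm hβ)

theorem sum_gradStack_consensus (hN : 2 ≤ N) (hsmooth : ∀ i, IsSmooth L (f i)) {w : Vec d}
    (hmin : IsMinOn (avgObj f) Set.univ w) : ∑ i, gradStack f (consensus N w) i = 0 := by
  have h : ∀ i ∈ Finset.univ,
      HasFDerivAt (f i) (InnerProductSpace.toDual ℝ (Vec d) (∇ (f i) w)) w :=
    fun i _ => hasGradientAt_iff_hasFDerivAt.1 ((hsmooth i).1 w).hasGradientAt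
  have h1 : HasFDerivAt (avgObj f) _ w := (HasFDerivAt.fun_sum h).const_mul (1 / (N : ℝ))
  have h2 := (hmin.isLocalMin univ_mem).hasFDerivAt_eq_zero h1
  have hN0 : (1 / (N : ℝ)) ≠ 0 := by positivity
  rw [← map_sum, smul_eq_zero] at h2
  exact (map_eq_zero_iff _ (InnerProductSpace.toDual ℝ (Vec d)).injective).1
    (h2.resolve_left hN0)

theorem norm_gradStack_consensus_le (w : Vec d) :
    ‖gradStack f (consensus N w)‖ ≤ Real.sqrt N * gradDiv f w := by
  have hb : ∀ i, ‖∇ (f i) w‖ ≤ gradDiv f w := fun i =>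
    le_ciSup (Set.finite_range fun i => ‖∇ (f i) w‖).bddAbove i
  have h0 : 0 ≤ gradDiv f w := Real.iSup_nonneg fun i => norm_nonneg _
  refine abs_le_of_sq_le_sq' ?_ (by positivity) |>.2
  rw [mul_pow, Real.sq_sqrt (Nat.cast_nonneg N), norm_sq_stack]
  calc ∑ i, ‖gradStack f (consensus N w) i‖ ^ 2 ≤ ∑ _i : Fin N, gradDiv f w ^ 2 :=
        Finset.sum_le_sum fun i _ => pow_le_pow_left₀ (norm_nonneg _) (hb i) 2
    _ = N * gradDiv f w ^ 2 := by simp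

/-- Penalty bias: the distance of the penalized minimizer from the consensus optimum. -/
theorem norm_critical_sub_consensus_le (hN : 2 ≤ N) (hμ : 0 < μ) (hμL : μ ≤ L)
    (hconv : ∀ i, StrongConvexOn Set.univ μ (f i))
    (hsmooth : ∀ i, IsSmooth L (f i)) (hℓ : IsLaplacian ℓ) (hconn : 0 < eig hℓ.symm 2)
    {w : Vec d} (hmin : IsMinOn (avgObj f) Set.univ w)
    {β : ℝ} (hβ : 0 < β) {X : Stack N d} (hX : gradStack f X + β • lapAct ℓ X = 0) :
    ‖X - consensus N w‖
      ≤ L / (μ * eig hℓ.symm 2 * β) * (Real.sqrt N * gradDiv f w) := by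
  have hL : 0 ≤ L := hμ.le.trans hμL
  have h := norm_le_of_add_lapAct_eq hN hℓ hconn hμ hL hβ
    (g := -gradStack f (consensus N w))
    (gradStack_strongMono hconv hsmooth X (consensus N w))
    (gradStack_lipschitz hL hsmooth X (consensus N w))
    (by rw [← lyapGrad_sub, hX, lapAct_consensus hℓ]; simp)
    (by simpa using sum_gradStack_consensus hN hsmooth hmin)
  rw [norm_neg] at h
  exact h.trans (mul_le_mul_of_nonneg_left (norm_gradStack_consensus_le w) (by positivity))

/-- Drift of the penalized minimizer when the penalty weight grows from `β` to `β'`. -/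
theorem norm_critical_sub_critical_le (hN : 2 ≤ N) (hμ : 0 < μ) (hμL : μ ≤ L)
    (hconv : ∀ i, StrongConvexOn Set.univ μ (f i))
    (hsmooth : ∀ i, IsSmooth L (f i)) (hℓ : IsLaplacian ℓ) (hconn : 0 < eig hℓ.symm 2)
    {w : Vec d} (hmin : IsMinOn (avgObj f) Set.univ w)
    {β β' : ℝ} (hβ : 0 < β) (hββ' : β ≤ β') {X X' : Stack N d}
    (hX : gradStack f X + β • lapAct ℓ X = 0) (hX' : gradStack f X' + β' • lapAct ℓ X' = 0) :
    ‖X' - X‖ ≤ L / (μ * eig hℓ.symm 2) * (1 / β - 1 / β')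
      * (Real.sqrt N * gradDiv f w * (1 + L ^ 2 / (μ * eig hℓ.symm 2) * (1 / β))) := by
  have hL : 0 ≤ L := hμ.le.trans hμL
  have hβ' : 0 < β' := hβ.trans_le hββ'
  have hgX : gradStack f X = -(β • lapAct ℓ X) := eq_neg_of_add_eq_zero_left hX
  have h := norm_le_of_add_lapAct_eq hN hℓ hconn hμ hL hβ'
    (g := ((β' - β) / β) • gradStack f X)
    (gradStack_strongMono hconv hsmooth X' X) (gradStack_lipschitz hL hsmooth X' X)
    (by
      rw [← lyapGrad_sub, hX', hgX]
      have : (β' - β) / β * β = β' - β := div_mul_cancel₀ _ hβ.ne'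
      rw [smul_neg, smul_smul, this]
      module)
    (by
      rw [hgX]
      simp only [PiLp.smul_apply, PiLp.neg_apply, ← Finset.smul_sum, Finset.sum_neg_distrib,
        sum_lapAct hℓ, smul_zero, neg_zero])
  have h1 := norm_critical_sub_consensus_le hN hμ hμL hconv hsmooth hℓ hconn hmin hβ hX
  have h2 := gradStack_lipschitz hL hsmooth X (consensus N w)
  have h3 := norm_gradStack_consensus_le (f := f) w
  have h4 : ‖gradStack f X‖ ≤ Real.sqrt N * gradDiv f w
      * (1 + L ^ 2 / (μ * eig hℓ.symm 2) * (1 / β)) := by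
    calc ‖gradStack f X‖
        = ‖gradStack f (consensus N w) + (gradStack f X - gradStack f (consensus N w))‖ := by
          rw [add_sub_cancel]
      _ ≤ _ := norm_add_le _ _
      _ ≤ Real.sqrt N * gradDiv f w + L * (L / (μ * eig hℓ.symm 2 * β)
          * (Real.sqrt N * gradDiv f w)) :=
          add_le_add h3 (h2.trans (mul_le_mul_of_nonneg_left h1 hL))
      _ = _ := by field_simp
  rw [norm_smul, Real.norm_of_nonneg (div_nonneg (by linarith) hβ.le)] at h
  refine h.trans ?_
  have e : L / (μ * eig hℓ.symm 2 * β') * ((β' - β) / β * ‖gradStack f X‖)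
      = L / (μ * eig hℓ.symm 2) * (1 / β - 1 / β') * ‖gradStack f X‖ := by field_simp
  rw [e]
  refine mul_le_mul_of_nonneg_left h4 (mul_nonneg (by positivity) ?_)
  rw [sub_nonneg]
  exact one_div_le_one_div_of_le hβ hββ'

/-- Once the unconstrained minimizer of the Lyapunov function is feasible, it is `lyapMin`. -/
theorem lyapMin_eq (hN : 2 ≤ N) (hμ : 0 < μ) (hconv : ∀ i, StrongConvexOn Set.univ μ (f i))
    (hsmooth : ∀ i, IsSmooth L (f i)) (hℓ : IsLaplacian ℓ) (hconn : 0 < eig hℓ.symm 2)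
    {γ η : ℝ} (hβ : 0 < γ / η) {𝒲 : Set (Vec d)} {X : Stack N d}
    (hX : gradStack f X + (γ / η) • lapAct ℓ X = 0) (hmem : X ∈ prodSet N 𝒲) :
    lyapMin f ℓ 𝒲 γ η = X := by
  have hq : ∀ Y, lyap f ℓ γ η X + μ / 2 * ‖Y - X‖ ^ 2 ≤ lyap f ℓ γ η Y := fun Y => by
    have := quadratic_le_of_gradient (hasGradientAt_lyap hsmooth hℓ.symm γ η)
      (lyapGrad_strongMono hN hconv hsmooth hℓ hconn hβ) X Y
    rw [hX] at this
    simpa using this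
  have hex : ∃ x, x ∈ prodSet N 𝒲 ∧ IsMinOn (lyap f ℓ γ η) (prodSet N 𝒲) x :=
    ⟨X, hmem, fun Y _ => by
      have := hq Y
      have : 0 ≤ μ / 2 * ‖Y - X‖ ^ 2 := by positivity
      simp only [Set.mem_ofPred_eq]
      linarith⟩
  obtain ⟨_, hm⟩ := argminOn_spec hex
  have h1 := hq (lyapMin f ℓ 𝒲 γ η)
  have h2 : lyap f ℓ γ η (lyapMin f ℓ 𝒲 γ η) ≤ lyap f ℓ γ η X := hm hmem
  have h3 : ‖lyapMin f ℓ 𝒲 γ η - X‖ = 0 := by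
    have : μ / 2 * ‖lyapMin f ℓ 𝒲 γ η - X‖ ^ 2 ≤ 0 := by linarith
    have : ‖lyapMin f ℓ 𝒲 γ η - X‖ ^ 2 ≤ 0 := by
      by_contra hc
      push Not at hc
      have := mul_pos (half_pos hμ) hc
      linarith
    exact pow_eq_zero_iff two_ne_zero |>.1 (le_antisymm this (sq_nonneg _))
  exact sub_eq_zero.1 (norm_eq_zero.1 h3)

end Objective

section Constraint

variable {N d : ℕ} {𝒲 : Set (Vec d)}

theorem closedBall_infDist_frontier_subset {E : Type*} [NormedAddCommGroup E] [NormedSpace ℝ E]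
    {S : Set E} (hS : IsClosed S) {x : E} (hx : x ∈ S) {y : E}
    (hy : ‖y - x‖ ≤ Metric.infDist x (frontier S)) : y ∈ S := by
  by_contra hyS
  have hseg : (segment ℝ x y ∩ frontier S).Nonempty := by
    by_contra hemp
    have hcov : segment ℝ x y ⊆ interior S ∪ Sᶜ := fun z hz => by
      by_contra hzu
      rw [Set.mem_union, not_or, Set.mem_compl_iff, not_not] at hzu
      exact hemp ⟨z, hz, subset_closure hzu.2, hzu.1⟩
    obtain ⟨z, _, hz1, hz2⟩ := (convex_segment x y).isPreconnected _ _ isOpen_interior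
      hS.isOpen_compl hcov ⟨x, left_mem_segment ℝ x y,
        (hcov (left_mem_segment ℝ x y)).resolve_right (not_not.2 hx)⟩
      ⟨y, right_mem_segment ℝ x y, hyS⟩
    exact hz2 (interior_subset hz1)
  obtain ⟨z, hz, hzf⟩ := hseg
  have h1 : Metric.infDist x (frontier S) ≤ dist x z := Metric.infDist_le_dist_of_mem hzf
  have h2 := dist_add_dist_of_mem_segment hz
  rw [dist_eq_norm x y, norm_sub_rev] at h2
  have h3 : dist z y = 0 := le_antisymm (by linarith) dist_nonneg
  exact hyS (dist_eq_zero.1 h3 ▸ hS.frontier_subset hzf)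

theorem mem_prodSet_of_norm_sub_le (hclosed : IsClosed 𝒲) {w : Vec d} (hw : w ∈ 𝒲)
    {X : Stack N d} (hX : ‖X - consensus N w‖ ≤ Metric.infDist w (frontier 𝒲)) :
    X ∈ prodSet N 𝒲 := fun i =>
  closedBall_infDist_frontier_subset hclosed hw ((norm_apply_le (X - consensus N w) i).trans hX)

theorem isClosed_prodSet (hclosed : IsClosed 𝒲) : IsClosed (prodSet N 𝒲) := by
  have : prodSet N 𝒲 = ⋂ i : Fin N, (fun W : Stack N d => W i) ⁻¹' 𝒲 := by
    ext W; simp [prodSet]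
  rw [this]
  exact isClosed_iInter fun i => hclosed.preimage (PiLp.continuous_apply 2 _ i)

theorem convex_prodSet (hconvex : Convex ℝ 𝒲) : Convex ℝ (prodSet N 𝒲) :=
  fun _ hX _ hY _ _ ha hb hab i => hconvex (hX i) (hY i) ha hb hab

theorem nonempty_prodSet {w : Vec d} (hw : w ∈ 𝒲) : (prodSet N 𝒲).Nonempty :=
  ⟨consensus N w, fun _ => hw⟩

theorem norm_sub_le_of_mem_prodSet (hbdd : Bornology.IsBounded 𝒲) {X Y : Stack N d}
    (hX : X ∈ prodSet N 𝒲) (hY : Y ∈ prodSet N 𝒲) :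
    ‖X - Y‖ ≤ Real.sqrt N * Metric.diam 𝒲 := by
  refine abs_le_of_sq_le_sq' ?_ (mul_nonneg (Real.sqrt_nonneg _) Metric.diam_nonneg) |>.2
  rw [mul_pow, Real.sq_sqrt (Nat.cast_nonneg N), norm_sq_stack]
  calc ∑ i, ‖(X - Y) i‖ ^ 2 ≤ ∑ _i : Fin N, Metric.diam 𝒲 ^ 2 :=
        Finset.sum_le_sum fun i _ => pow_le_pow_left₀ (norm_nonneg _)
          (by rw [PiLp.sub_apply, ← dist_eq_norm]
              exact Metric.dist_le_diam_of_mem hbdd (hX i) (hY i)) 2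
    _ = N * Metric.diam 𝒲 ^ 2 := by simp

/-- In positive dimension a bounded set has nonempty frontier, so that the distance to the frontier
is not the junk value `0` of `infDist` to the empty set. -/
theorem infDist_frontier_pos (hd : 1 ≤ d) (hbdd : Bornology.IsBounded 𝒲) {w : Vec d}
    (hint : w ∈ interior 𝒲) : 0 < Metric.infDist w (frontier 𝒲) := by
  have : Nonempty (Fin d) := ⟨⟨0, hd⟩⟩
  have hne : (frontier 𝒲).Nonempty := by
    rw [nonempty_frontier_iff]
    refine ⟨⟨w, interior_subset hint⟩, fun h => ?_⟩
    rw [h] at hbdd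
    exact NormedSpace.unbounded_univ ℝ (Vec d) hbdd
  refine (isClosed_frontier.notMem_iff_infDist_pos hne).1 fun h => ?_
  exact h.2 hint

end Constraint

/-! ### Scalar recursions -/

section Recursion

/-- One step of the recursion for the noise variance, with `x = μ η_k` and `y = δ / t_k`. The slack
`x / 5` pays for the fresh noise: the constant `c = 5 e² / (4 a)` of the bound satisfies
`1 / c ≤ a / 5` because `5 ≤ e²`. -/
theorem noise_step {x y : ℝ} (hx0 : 0 ≤ x) (hx1 : x ≤ 1) (hy0 : 0 ≤ y) (hy : y ≤ 4 / 5 * x) :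
    (1 - x) ^ 2 + x / 5 ≤ 1 / (1 + y) := by
  have h1 : (1 - x) ^ 2 + x / 5 ≤ 1 / (1 + 4 / 5 * x) := by
    rw [le_div_iff₀ (by positivity)]
    have : 0 ≤ x * (1 - x) := mul_nonneg hx0 (by linarith)
    have : 0 ≤ x * (x * (1 - x)) := mul_nonneg hx0 this
    nlinarith
  exact h1.trans (one_div_le_one_div_of_le (by positivity) (by linarith))

theorem five_le_exp_one_sq : 5 ≤ Real.exp 1 ^ 2 := by
  have := Real.exp_one_gt_d9
  nlinarith

/-- The scaled noise level `(p + q t^{-1/4})² t^{-1/2}` decreases at most like `1 / t`. -/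
theorem noise_level_le {p q t t' : ℝ} (hp : 0 ≤ p) (hq : 0 ≤ q) (ht : 0 < t) (htt' : t ≤ t') :
    ((p + q * t ^ (-(1 / 4) : ℝ)) * t ^ (-(1 / 4) : ℝ)) ^ 2 * (t / t')
      ≤ ((p + q * t' ^ (-(1 / 4) : ℝ)) * t' ^ (-(1 / 4) : ℝ)) ^ 2 := by
  have ht' : 0 < t' := ht.trans_le htt'
  -- `t' ^ (-1/4) = r * t ^ (-1/4)` with `r ^ 4 = t / t'`
  set r := (t / t') ^ ((1 : ℝ) / 4) with hr
  have hr0 : 0 ≤ r := by positivity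
  have hr1 : r ≤ 1 := Real.rpow_le_one (by positivity) ((div_le_one ht').2 htt') (by norm_num)
  have hr4 : t / t' = r ^ 4 := by
    rw [hr, ← Real.rpow_natCast, ← Real.rpow_mul (by positivity)]; norm_num
  have e : t' ^ (-(1 / 4) : ℝ) = r * t ^ (-(1 / 4) : ℝ) := by
    rw [hr, Real.div_rpow ht.le ht'.le, Real.rpow_neg ht.le, Real.rpow_neg ht'.le]
    have : t ^ ((1 : ℝ) / 4) ≠ 0 := (Real.rpow_pos_of_pos ht _).ne'
    field_simp
  rw [e, hr4]
  set τ := t ^ (-(1 / 4) : ℝ)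
  have hτ : 0 ≤ τ := by positivity
  have h1 : ((p + q * τ) * τ) * r ^ 2 ≤ (p + q * (r * τ)) * (r * τ) := by
    have h2 : (p + q * τ) * r ≤ p + q * (r * τ) := by
      have := mul_le_of_le_one_right hp hr1
      linarith
    calc ((p + q * τ) * τ) * r ^ 2 = ((p + q * τ) * r) * (r * τ) := by ring
      _ ≤ _ := mul_le_mul_of_nonneg_right h2 (by positivity)
  calc ((p + q * τ) * τ) ^ 2 * r ^ 4 = (((p + q * τ) * τ) * r ^ 2) ^ 2 := by ring
    _ ≤ _ := pow_le_pow_left₀ (by positivity) h1 2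

/-- The variance recursion `v_{k+1} ≤ (1 - a/t_k)² v_k + s_k²` with noise level
`s_k = (p + q t_k^{-1/4}) t_k^{-3/4}` keeps `v_k` below `5 e² / (4 a)` times `t_k s_k²`. -/
theorem noise_recursion {a δ p q : ℝ} (hδ : 0 < δ) (hδa : δ ≤ 4 / 5 * a)
    (hp : 0 ≤ p) (hq : 0 ≤ q) {κ : ℕ} {v : ℕ → ℝ} (hκ : v κ = 0)
    (ha1 : ∀ k, κ ≤ k → a ≤ 1 + δ * k)
    (hv : ∀ k, κ ≤ k → v (k + 1) ≤ (1 - a / (1 + δ * k)) ^ 2 * v k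
      + ((p + q * (1 + δ * k) ^ (-(1 / 4) : ℝ)) * (1 + δ * k) ^ (-(1 / 4) : ℝ)) ^ 2
        / (1 + δ * k)) (k : ℕ) (hk : κ ≤ k) :
    v k ≤ 5 * Real.exp 1 ^ 2 / (4 * a)
      * ((p + q * (1 + δ * k) ^ (-(1 / 4) : ℝ)) * (1 + δ * k) ^ (-(1 / 4) : ℝ)) ^ 2 := by
  have ha : 0 < a := by linarith
  induction k, hk using Nat.le_induction with
  | base => rw [hκ]; positivity
  | succ k hk ih =>
    set t := 1 + δ * (k : ℝ) with ht
    have ht0 : 0 < t := by positivity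
    have ht' : 1 + δ * ((k + 1 : ℕ) : ℝ) = t + δ := by rw [ht]; push_cast; ring
    rw [ht']
    have hlev := noise_level_le hp hq ht0 (by linarith : t ≤ t + δ)
    set c := 5 * Real.exp 1 ^ 2 / (4 * a) with hc
    have hc0 : 0 < c := by positivity
    set B := ((p + q * t ^ (-(1 / 4) : ℝ)) * t ^ (-(1 / 4) : ℝ)) ^ 2
    have hB : 0 ≤ B := by positivity
    have hstep := noise_step (x := a / t) (y := δ / t) (by positivity)
      ((div_le_one ht0).2 (ha1 k hk)) (by positivity)
      (by rw [← mul_div_assoc]; exact div_le_div_of_nonneg_right hδa ht0.le)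
    have e1 : 1 / (1 + δ / t) = t / (t + δ) := by field_simp
    rw [e1] at hstep
    have h1 : 1 ≤ c * (a / 5) := by
      have : c * (a / 5) = Real.exp 1 ^ 2 / 4 := by rw [hc]; field_simp
      rw [this]
      linarith [five_le_exp_one_sq]
    have h2 : B / t ≤ c * B * (a / t / 5) := by
      have : c * B * (a / t / 5) = c * (a / 5) * (B / t) := by field_simp
      rw [this]
      exact le_mul_of_one_le_left (by positivity) h1
    calc v (k + 1) ≤ (1 - a / t) ^ 2 * v k + B / t := hv k hk
      _ ≤ (1 - a / t) ^ 2 * (c * B) + c * B * (a / t / 5) := by gcongr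
      _ = c * B * ((1 - a / t) ^ 2 + a / t / 5) := by ring
      _ ≤ c * B * (t / (t + δ)) := by gcongr
      _ = c * (B * (t / (t + δ))) := by ring
      _ ≤ _ := by gcongr

theorem one_sub_mul_le_rpow_neg {y s : ℝ} (hy : 0 ≤ y) (hs : 0 ≤ s) :
    1 - s * y ≤ (1 + y) ^ (-s) := by
  have h1 : 1 - s * y ≤ Real.exp (-(s * y)) := by linarith [Real.add_one_le_exp (-(s * y))]
  refine h1.trans ?_
  rw [Real.rpow_def_of_pos (by linarith), Real.exp_le_exp]
  have := Real.log_le_sub_one_of_pos (by linarith : 0 < 1 + y)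
  nlinarith

theorem one_add_div_eq {δ : ℝ} (hδ : 0 < δ) (κ k : ℕ) :
    1 + δ * ((k : ℝ) - (κ : ℝ)) / (1 + δ * κ) = (1 + δ * k) / (1 + δ * κ) := by
  have : 0 < 1 + δ * (κ : ℝ) := by positivity
  field_simp
  ring

/-- One step of the drift bound `θ (1 + b τ) τ`, where `y = δ / t` and `r = τ_{k+1} / τ_k`; the
terms of order `τ` and `τ²` are compared separately, and the latter requires `θ ≥ 1/3`. -/
theorem drift_step {y r θ b τ : ℝ} (hθ : 1 / 3 ≤ θ) (hy : 0 ≤ y) (hr1 : r ≤ 1)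
    (hry : 1 - r ≤ y / 4) (hb : 0 ≤ b) (hτ : 0 ≤ τ) :
    (1 - 5 / 4 * y) * (θ * (1 + b * τ) * τ) + (τ - r * τ) * (1 + b * τ)
      ≤ θ * (1 + b * (r * τ)) * (r * τ) := by
  have hθ0 : 0 ≤ θ := by linarith
  have hyθ : 1 / 3 * y ≤ θ * y := mul_le_mul_of_nonneg_right hθ hy
  have h1 : (1 - 5 / 4 * y) * θ + (1 - r) ≤ θ * r := by
    have := mul_le_mul_of_nonneg_left hry hθ0
    linarith
  have h2 : (1 - 5 / 4 * y) * θ + (1 - r) ≤ θ * r ^ 2 := by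
    have h3 : 1 - r ^ 2 ≤ y / 2 := by nlinarith
    have := mul_le_mul_of_nonneg_left h3 hθ0
    linarith
  have h1' := mul_le_mul_of_nonneg_right h1 hτ
  have h2' := mul_le_mul_of_nonneg_right h2 (by positivity : 0 ≤ b * τ ^ 2)
  linarith

/-- The tracking recursion `p_{k+1} ≤ (1 - a/t_k) p_k + C (τ_k - τ_{k+1}) (1 + b τ_k)`, where
`τ_k = t_k^{-1/4}`: the initial error decays like `t^{-5/4}` and the drift accumulates to the
order of `τ_k`. -/
theorem tracking_recursion {a δ C b M : ℝ} (hδ : 0 < δ) (hδa : δ ≤ 4 / 5 * a)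
    (hC : 0 ≤ C) (hb : 0 ≤ b) (hM : 0 ≤ M) {κ : ℕ} {p : ℕ → ℝ} (hκ : p κ ≤ M)
    (ha1 : ∀ k, κ ≤ k → a ≤ 1 + δ * k)
    (hp : ∀ k : ℕ, κ ≤ k → p (k + 1) ≤ (1 - a / (1 + δ * k)) * p k
      + C * ((1 + δ * k) ^ (-(1 / 4) : ℝ) - (1 + δ * ((k + 1 : ℕ) : ℝ)) ^ (-(1 / 4) : ℝ))
        * (1 + b * (1 + δ * k) ^ (-(1 / 4) : ℝ))) (k : ℕ) (hk : κ ≤ k) :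
    p k ≤ M * (1 + δ * ((k : ℝ) - (κ : ℝ)) / (1 + δ * κ)) ^ (-(5 / 4) : ℝ)
      + C * (Real.exp 1 / 4) * (1 + b * (1 + δ * k) ^ (-(1 / 4) : ℝ))
        * (1 + δ * k) ^ (-(1 / 4) : ℝ) := by
  have ha : 0 < a := by linarith
  rw [one_add_div_eq hδ]
  induction k, hk using Nat.le_induction with
  | base =>
    have : 0 < 1 + δ * (κ : ℝ) := by positivity
    rw [div_self this.ne', Real.one_rpow, mul_one]
    have : 0 ≤ C * (Real.exp 1 / 4) * (1 + b * (1 + δ * κ) ^ (-(1 / 4) : ℝ))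
        * (1 + δ * κ) ^ (-(1 / 4) : ℝ) := by positivity
    linarith
  | succ k hk ih =>
    have hrec := hp k hk
    have ha1k := ha1 k hk
    set t := 1 + δ * (k : ℝ) with ht
    have ht0 : 0 < t := by positivity
    have ht' : 1 + δ * ((k + 1 : ℕ) : ℝ) = t + δ := by rw [ht]; push_cast; ring
    rw [ht'] at hrec ⊢
    set θ := Real.exp 1 / 4 with hθ
    have hθ3 : 1 / 3 ≤ θ := by rw [hθ]; linarith [Real.exp_one_gt_d9]
    set s := 1 + δ * (κ : ℝ)
    have hs : 0 < s := by positivity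
    set y := δ / t with hy
    have hy0 : 0 ≤ y := by positivity
    have hay : 5 / 4 * y ≤ a / t := by
      rw [hy, ← mul_div_assoc]; exact div_le_div_of_nonneg_right (by linarith) ht0.le
    have hfac : t + δ = t * (1 + y) := by rw [hy]; field_simp
    set τ := t ^ (-(1 / 4) : ℝ) with hτ
    have hτ0 : 0 ≤ τ := by positivity
    set r := (1 + y) ^ (-(1 / 4) : ℝ) with hr
    have hr0 : 0 ≤ r := by positivity
    have hr1 : r ≤ 1 := Real.rpow_le_one_of_one_le_of_nonpos (by linarith) (by norm_num)
    have hτ' : (t + δ) ^ (-(1 / 4) : ℝ) = r * τ := by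
      rw [hfac, Real.mul_rpow ht0.le (by positivity), mul_comm]
    have hry : 1 - r ≤ y / 4 := by
      have := one_sub_mul_le_rpow_neg (s := 1 / 4) hy0 (by norm_num)
      linarith
    have hdec : (1 - 5 / 4 * y) * (t / s) ^ (-(5 / 4) : ℝ) ≤ ((t + δ) / s) ^ (-(5 / 4) : ℝ) := by
      have : (t + δ) / s = (1 + y) * (t / s) := by rw [hfac]; ring
      rw [this, Real.mul_rpow (by positivity) (by positivity)]
      exact mul_le_mul_of_nonneg_right
        (one_sub_mul_le_rpow_neg (s := 5 / 4) hy0 (by norm_num)) (by positivity)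
    rw [hτ'] at hrec ⊢
    have hat : 0 ≤ 1 - a / t := by
      rw [sub_nonneg, div_le_one ht0]; exact ha1k
    have hdrift := drift_step (τ := τ) hθ3 hy0 hr1 hry hb hτ0
    set R := (t / s) ^ (-(5 / 4) : ℝ)
    have hR : 0 ≤ R := by positivity
    set T := θ * (1 + b * τ) * τ with hT
    have hT0 : 0 ≤ T := by positivity
    have hih : p k ≤ M * R + C * T := by rw [hT]; linarith
    have hMR : 0 ≤ M * R + C * T := by positivity
    have s1 := mul_le_mul_of_nonneg_left hih hat
    have s2 := mul_le_mul_of_nonneg_right (by linarith : 1 - a / t ≤ 1 - 5 / 4 * y) hMR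
    have s3 := mul_le_mul_of_nonneg_left hdec hM
    have s4 := mul_le_mul_of_nonneg_left hdrift hC
    linarith

end Recursion

/-! ### Mean-square estimates for noise -/

section MeanSquare

variable {Ω : Type*} {m mΩ : MeasurableSpace Ω} {P : Measure Ω}
  {E : Type*} [NormedAddCommGroup E] [InnerProductSpace ℝ E]

theorem integrable_inner_of_memLp {X Y : Ω → E} (hX : MemLp X 2 P) (hY : MemLp Y 2 P) :
    Integrable (fun ω => (inner ℝ (X ω) (Y ω) : ℝ)) P := by
  refine ((hX.integrable_norm_pow two_ne_zero).add (hY.integrable_norm_pow two_ne_zero)).mono'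
    (hX.1.inner hY.1) (ae_of_all _ fun ω => ?_)
  have := norm_inner_le_norm (𝕜 := ℝ) (X ω) (Y ω)
  simp only [Pi.add_apply]
  nlinarith [sq_nonneg (‖X ω‖ - ‖Y ω‖), norm_nonneg (X ω), norm_nonneg (Y ω)]

/-- Pythagoras for a martingale increment: conditionally centred noise is orthogonal in mean square
to everything known beforehand. -/
theorem integral_norm_add_sq_of_condExp_eq_zero [CompleteSpace E] [IsProbabilityMeasure P]
    (hm : m ≤ mΩ) {X ξ : Ω → E}
    (hXm : StronglyMeasurable[m] X) (hX : MemLp X 2 P) (hξ : MemLp ξ 2 P)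
    (h0 : P[ξ | m] =ᵐ[P] 0) :
    ∫ ω, ‖X ω + ξ ω‖ ^ 2 ∂P = ∫ ω, ‖X ω‖ ^ 2 ∂P + ∫ ω, ‖ξ ω‖ ^ 2 ∂P := by
  have hint := integrable_inner_of_memLp hX hξ
  have hpull := condExp_bilin_of_stronglyMeasurable_left (μ := P) (innerSL ℝ) hXm
    hint (hξ.integrable one_le_two)
  have hcross : ∫ ω, (inner ℝ (X ω) (ξ ω) : ℝ) ∂P = 0 := by
    rw [← integral_condExp hm]
    refine integral_eq_zero_of_ae ?_
    filter_upwards [hpull, h0] with ω h1 h2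
    rw [h2] at h1
    exact h1.trans (inner_zero_right (X ω))
  have hX2 := hX.integrable_norm_pow two_ne_zero
  have hξ2 := hξ.integrable_norm_pow two_ne_zero
  simp_rw [norm_add_sq_real]
  rw [integral_add (by exact hX2.add (hint.const_mul 2)) hξ2, integral_add hX2 (hint.const_mul 2),
    integral_const_mul, hcross]
  ring

/-- Minkowski's inequality in mean square. -/
theorem integral_norm_sub_sq_le {X Y : Ω → E} (hX : MemLp X 2 P) (hY : MemLp Y 2 P) :
    ∫ ω, ‖X ω - Y ω‖ ^ 2 ∂P
      ≤ (Real.sqrt (∫ ω, ‖X ω‖ ^ 2 ∂P) + Real.sqrt (∫ ω, ‖Y ω‖ ^ 2 ∂P)) ^ 2 := by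
  have hX2 := hX.integrable_norm_pow two_ne_zero
  have hY2 := hY.integrable_norm_pow two_ne_zero
  have hint := integrable_inner_of_memLp hX hY
  have hX' : MemLp (fun ω => ‖X ω‖) (ENNReal.ofReal 2) P := by simpa using hX.norm
  have hY' : MemLp (fun ω => ‖Y ω‖) (ENNReal.ofReal 2) P := by simpa using hY.norm
  have hcs := integral_mul_le_Lp_mul_Lq_of_nonneg Real.HolderConjugate.two_two
    (ae_of_all _ fun ω => norm_nonneg (X ω)) (ae_of_all _ fun ω => norm_nonneg (Y ω)) hX' hY'
  simp only [Real.rpow_two, ← Real.sqrt_eq_rpow] at hcs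
  have hprod : Integrable (fun ω => ‖X ω‖ * ‖Y ω‖) P := by
    have := integrable_inner_of_memLp hX.norm hY.norm
    simpa [mul_comm] using this
  have hcross : -∫ ω, (inner ℝ (X ω) (Y ω) : ℝ) ∂P ≤ ∫ ω, ‖X ω‖ * ‖Y ω‖ ∂P := by
    rw [← integral_neg]
    exact integral_mono hint.neg hprod fun ω =>
      (neg_le_abs _).trans (abs_real_inner_le_norm _ _)
  have hI : ∫ ω, ‖X ω - Y ω‖ ^ 2 ∂P = ∫ ω, ‖X ω‖ ^ 2 ∂P
      - 2 * ∫ ω, (inner ℝ (X ω) (Y ω) : ℝ) ∂P + ∫ ω, ‖Y ω‖ ^ 2 ∂P := by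
    simp_rw [norm_sub_sq_real]
    rw [integral_add (by exact hX2.sub (hint.const_mul 2)) hY2, integral_sub hX2 (hint.const_mul 2),
      integral_const_mul]
  rw [hI, add_sq, Real.sq_sqrt (integral_nonneg fun ω => sq_nonneg _),
    Real.sq_sqrt (integral_nonneg fun ω => sq_nonneg _)]
  linarith

/-- One noisy step: adding two scaled, conditionally centred noise terms increases the second moment
by at most the square of the sum of the noise levels. -/
theorem integral_norm_noisy_step_le [CompleteSpace E] [IsProbabilityMeasure P] (hm : m ≤ mΩ)
    {X D G : Ω → E} (hXm : StronglyMeasurable[m] X) (hX : MemLp X 2 P) (hD : MemLp D 2 P)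
    (hG : MemLp G 2 P) {γ η V₁ V₂ : ℝ} (hγ : 0 ≤ γ) (hη : 0 ≤ η)
    (hV₁ : ∫ ω, ‖D ω - (P[D | m]) ω‖ ^ 2 ∂P ≤ V₁)
    (hV₂ : ∫ ω, ‖G ω - (P[G | m]) ω‖ ^ 2 ∂P ≤ V₂) :
    ∫ ω, ‖X ω + (γ • (D ω - (P[D | m]) ω) - η • (G ω - (P[G | m]) ω))‖ ^ 2 ∂P
      ≤ ∫ ω, ‖X ω‖ ^ 2 ∂P + (γ * Real.sqrt V₁ + η * Real.sqrt V₂) ^ 2 := by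
  have hD' : MemLp (fun ω => γ • (D ω - (P[D | m]) ω)) 2 P :=
    (hD.sub (hD.condExp one_le_two)).const_smul γ
  have hG' : MemLp (fun ω => η • (G ω - (P[G | m]) ω)) 2 P :=
    (hG.sub (hG.condExp one_le_two)).const_smul η
  have hcent : ∀ {Z : Ω → E} (c : ℝ), MemLp Z 2 P →
      P[fun ω => c • (Z ω - (P[Z | m]) ω) | m] =ᵐ[P] 0 := by
    intro Z c hZ
    have hZi := hZ.integrable one_le_two
    have h1 : P[c • (Z - P[Z | m]) | m] =ᵐ[P] c • P[Z - P[Z | m] | m] := condExp_smul c _ m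
    have h2 : P[Z - P[Z | m] | m] =ᵐ[P] P[Z | m] - P[P[Z | m] | m] :=
      condExp_sub hZi integrable_condExp m
    rw [condExp_of_stronglyMeasurable hm stronglyMeasurable_condExp integrable_condExp,
      sub_self] at h2
    refine h1.trans ?_
    filter_upwards [h2] with ω h
    rw [Pi.smul_apply, h]
    simp
  have h0 : P[fun ω => γ • (D ω - (P[D | m]) ω) - η • (G ω - (P[G | m]) ω) | m] =ᵐ[P] 0 := by
    refine (condExp_sub (hD'.integrable one_le_two) (hG'.integrable one_le_two) m).trans ?_
    filter_upwards [hcent γ hD, hcent η hG] with ω h1 h2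
    rw [Pi.sub_apply, h1, h2]
    simp
  refine (integral_norm_add_sq_of_condExp_eq_zero hm hXm hX (hD'.sub hG') h0).trans_le ?_
  gcongr
  have hsc : ∀ {Z : Ω → E} {c V : ℝ}, 0 ≤ c → ∫ ω, ‖Z ω‖ ^ 2 ∂P ≤ V →
      Real.sqrt (∫ ω, ‖c • Z ω‖ ^ 2 ∂P) ≤ c * Real.sqrt V := by
    intro Z c V hc hV
    simp_rw [norm_smul, mul_pow]
    rw [integral_const_mul, Real.sqrt_mul (by positivity), Real.sqrt_sq (norm_nonneg _),
      Real.norm_of_nonneg hc]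
    exact mul_le_mul_of_nonneg_left (Real.sqrt_le_sqrt hV) hc
  refine (integral_norm_sub_sq_le hD' hG').trans ?_
  exact pow_le_pow_left₀ (by positivity) (add_le_add (hsc hγ hV₁) (hsc hη hV₂)) 2

theorem integral_le_of_condExp_le [IsProbabilityMeasure P] (hm : m ≤ mΩ) {Z : Ω → ℝ} {N : ℕ}
    (hN : 0 < N) {S : ℝ} (h : ∀ᵐ ω ∂P, (1 / (N : ℝ)) * (P[Z | m]) ω ≤ S) :
    ∫ ω, Z ω ∂P ≤ N * S := by
  rw [← integral_condExp hm]
  have hN' : (0 : ℝ) < N := by exact_mod_cast hN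
  calc ∫ ω, (P[Z | m]) ω ∂P ≤ ∫ _ω, (N : ℝ) * S ∂P := by
        refine integral_mono_ae integrable_condExp (integrable_const _) ?_
        filter_upwards [h] with ω hω
        rw [one_div, inv_mul_le_iff₀ hN'] at hω
        exact hω
    _ = N * S := by simp

theorem normE_add_le {X Y : Ω → E} (hX : MemLp X 2 P) (hY : MemLp Y 2 P) :
    normE P (fun ω => X ω + Y ω) ≤ normE P X + normE P Y := by
  have h := (Real.sqrt_le_sqrt (integral_norm_sub_sq_le hX hY.neg)).trans_eq
    (Real.sqrt_sq (add_nonneg (Real.sqrt_nonneg _) (Real.sqrt_nonneg _)))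
  simpa [normE] using h

end MeanSquare

theorem normE_le_of_forall_norm_le {Ω : Type*} [MeasurableSpace Ω] {P : Measure Ω}
    [IsProbabilityMeasure P] {E : Type*} [NormedAddCommGroup E] {X : Ω → E} {C : ℝ} (hC : 0 ≤ C)
    (hX : MemLp X 2 P) (h : ∀ ω, ‖X ω‖ ≤ C) : normE P X ≤ C := by
  rw [normE, ← Real.sqrt_sq hC]
  refine Real.sqrt_le_sqrt ?_
  calc ∫ ω, ‖X ω‖ ^ 2 ∂P ≤ ∫ _ω, C ^ 2 ∂P :=
        integral_mono (hX.integrable_norm_pow two_ne_zero) (integrable_const _)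
          fun ω => pow_le_pow_left₀ (norm_nonneg _) (h ω) 2
    _ = C ^ 2 := by simp

/-! ### Stepsizes and deterministic dynamics -/

section Stepsizes

variable {γ₀ η₀ δ : ℝ}

theorem consStep_pos (hγ₀ : 0 < γ₀) (hδ : 0 < δ) (k : ℕ) : 0 < consStep γ₀ δ k := by
  unfold consStep; positivity

theorem learnStep_pos (hη₀ : 0 < η₀) (hδ : 0 < δ) (k : ℕ) : 0 < learnStep η₀ δ k := by
  unfold learnStep; positivity

theorem learnStep_eq (hδ : 0 < δ) (k : ℕ) : learnStep η₀ δ k = η₀ / (1 + δ * k) := by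
  have : 0 ≤ 1 + δ * (k : ℝ) := by positivity
  rw [learnStep, Real.rpow_neg this, Real.rpow_one, div_eq_mul_inv]

theorem inv_penalty_eq (hγ₀ : 0 < γ₀) (hη₀ : 0 < η₀) (hδ : 0 < δ) (k : ℕ) :
    1 / (consStep γ₀ δ k / learnStep η₀ δ k) = η₀ / γ₀ * (1 + δ * k) ^ (-(1 / 4) : ℝ) := by
  have ht : 0 < 1 + δ * (k : ℝ) := by positivity
  rw [one_div_div, div_eq_iff (consStep_pos hγ₀ hδ k).ne', learnStep, consStep]
  have e : (1 + δ * (k : ℝ)) ^ (-1 : ℝ)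
      = (1 + δ * (k : ℝ)) ^ (-(1 / 4) : ℝ) * (1 + δ * (k : ℝ)) ^ (-(3 / 4) : ℝ) := by
    rw [← Real.rpow_add ht]; norm_num
  rw [e]
  field_simp

theorem penalty_mono (hγ₀ : 0 < γ₀) (hη₀ : 0 < η₀) (hδ : 0 < δ) (k : ℕ) :
    consStep γ₀ δ k / learnStep η₀ δ k ≤ consStep γ₀ δ (k + 1) / learnStep η₀ δ (k + 1) := by
  refine le_of_one_div_le_one_div (div_pos (consStep_pos hγ₀ hδ _) (learnStep_pos hη₀ hδ _)) ?_
  rw [inv_penalty_eq hγ₀ hη₀ hδ, inv_penalty_eq hγ₀ hη₀ hδ]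
  refine mul_le_mul_of_nonneg_left ?_ (by positivity)
  refine Real.rpow_le_rpow_of_nonpos (by positivity) ?_ (by norm_num)
  push_cast
  nlinarith

theorem noise_level_eq (hδ : 0 < δ) (s₁ s₂ : ℝ) (k : ℕ) :
    (consStep γ₀ δ k * s₁ + learnStep η₀ δ k * s₂) ^ 2
      = ((γ₀ * s₁ + η₀ * s₂ * (1 + δ * k) ^ (-(1 / 4) : ℝ)) * (1 + δ * k) ^ (-(1 / 4) : ℝ)) ^ 2
        / (1 + δ * k) := by
  have ht : 0 < 1 + δ * (k : ℝ) := by positivity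
  rw [consStep, learnStep]
  set t := 1 + δ * (k : ℝ)
  set τ := t ^ (-(1 / 4) : ℝ) with hτ
  have e1 : t ^ (-(3 / 4) : ℝ) = τ ^ 3 := by
    rw [hτ, ← Real.rpow_natCast, ← Real.rpow_mul ht.le]; norm_num
  have e2 : t ^ (-1 : ℝ) = τ ^ 4 := by
    rw [hτ, ← Real.rpow_natCast, ← Real.rpow_mul ht.le]; norm_num
  have e3 : t⁻¹ = τ ^ 4 := by rw [← e2, Real.rpow_neg ht.le, Real.rpow_one]
  rw [e1, e2, div_eq_mul_inv _ t, e3]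
  ring

theorem tendsto_base (hδ : 0 < δ) : Tendsto (fun k : ℕ => 1 + δ * (k : ℝ)) atTop atTop :=
  tendsto_atTop_add_const_left _ _ (tendsto_natCast_atTop_atTop.const_mul_atTop hδ)

theorem exists_smallSteps (hγ₀ : 0 < γ₀) (hη₀ : 0 < η₀) (hδ : 0 < δ) (N : ℕ) {μ L ρ₂ ρN ζ : ℝ}
    (gradStar : ℝ) (hμ : 0 < μ) (hρ₂ : 0 < ρ₂) (hζ : 0 < ζ) :
    ∃ κ, SmallSteps N μ L ρ₂ ρN ζ gradStar (consStep γ₀ δ) (learnStep η₀ δ) κ := by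
  have hb := tendsto_base hδ
  have h1 : Tendsto (consStep γ₀ δ) atTop (𝓝 0) := by
    change Tendsto (fun k : ℕ => consStep γ₀ δ k) atTop (𝓝 0)
    simpa [consStep] using
      ((tendsto_rpow_neg_atTop (y := 3 / 4) (by norm_num)).comp hb).const_mul γ₀
  have h2 : Tendsto (learnStep η₀ δ) atTop (𝓝 0) := by
    change Tendsto (fun k : ℕ => learnStep η₀ δ k) atTop (𝓝 0)
    simpa [learnStep] using
      ((tendsto_rpow_neg_atTop (y := 1) (by norm_num)).comp hb).const_mul η₀
  have h3 : Tendsto (fun k : ℕ => η₀ / γ₀ * (1 + δ * (k : ℝ)) ^ (-(1 / 4) : ℝ)) atTop (𝓝 0) := by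
    simpa using ((tendsto_rpow_neg_atTop (y := 1 / 4) (by norm_num)).comp hb).const_mul (η₀ / γ₀)
  have h4 : Tendsto (fun k => learnStep η₀ δ k * (μ + L) + consStep γ₀ δ k * ρN) atTop (𝓝 0) := by
    simpa using (h2.mul_const (μ + L)).add (h1.mul_const ρN)
  have h5 := h3.mul_const (Real.sqrt N * gradStar * L)
  rw [zero_mul] at h5
  obtain ⟨κ, hκ⟩ := eventually_atTop.1 ((h4.eventually_le_const zero_lt_two).and
    (h5.eventually_le_const (by positivity : 0 < ζ * μ * ρ₂)))
  refine ⟨κ, fun k hk => ⟨(hκ k hk).1, ?_⟩⟩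
  have h6 := (hκ k hk).2
  rw [← inv_penalty_eq hγ₀ hη₀ hδ, one_div_div, div_mul_eq_mul_div,
    div_le_iff₀ (consStep_pos hγ₀ hδ k)] at h6
  linarith

end Stepsizes

/-- The standing assumptions on the optimization problem: `μ`-strongly convex, `L`-smooth local
objectives, Laplacian weights of a connected graph, and a compact convex constraint set containing
the global optimum in its interior. -/
structure Problem {N d : ℕ} (f : Fin N → Vec d → ℝ) (μ L : ℝ) (ℓ : Matrix (Fin N) (Fin N) ℝ)
    (𝒲 : Set (Vec d)) (w : Vec d) : Prop where
  two_le : 2 ≤ N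
  one_le : 1 ≤ d
  mu_pos : 0 < μ
  conv : ∀ i, StrongConvexOn Set.univ μ (f i)
  smooth : ∀ i, IsSmooth L (f i)
  lap : IsLaplacian ℓ
  conn : 0 < eig lap.symm 2
  closed : IsClosed 𝒲
  convex : Convex ℝ 𝒲
  bdd : Bornology.IsBounded 𝒲
  isMin : IsMinOn (avgObj f) Set.univ w
  mem_interior : w ∈ interior 𝒲

namespace Problem

variable {N d : ℕ} {f : Fin N → Vec d → ℝ} {μ L : ℝ} {ℓ : Matrix (Fin N) (Fin N) ℝ}
  {𝒲 : Set (Vec d)} {w : Vec d}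

theorem mem (p : Problem f μ L ℓ 𝒲 w) : w ∈ 𝒲 := interior_subset p.mem_interior

theorem mu_le (p : Problem f μ L ℓ 𝒲 w) : μ ≤ L := modulus_le p.two_le p.one_le p.conv p.smooth

theorem L_nonneg (p : Problem f μ L ℓ 𝒲 w) : 0 ≤ L := p.mu_pos.le.trans p.mu_le

theorem eig_pos (p : Problem f μ L ℓ 𝒲 w) : 0 < eig p.lap.symm N :=
  p.conn.trans_le (eig_two_le_eig p.two_le _)

theorem gradient_lyap (p : Problem f μ L ℓ 𝒲 w) (γ η : ℝ) (X : Stack N d) :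
    ∇ (lyap f ℓ γ η) X = gradStack f X + (γ / η) • lapAct ℓ X :=
  (hasGradientAt_lyap p.smooth p.lap.symm γ η X).gradient

theorem gradient_sumObj (p : Problem f μ L ℓ 𝒲 w) (X : Stack N d) :
    ∇ (sumObj f) X = gradStack f X := (hasGradientAt_sumObj p.smooth X).gradient

theorem proj_mem (p : Problem f μ L ℓ 𝒲 w) (X : Stack N d) :
    proj (prodSet N 𝒲) X ∈ prodSet N 𝒲 :=
  (proj_spec (nonempty_prodSet p.mem) (isClosed_prodSet p.closed) (convex_prodSet p.convex) X).1

theorem proj_sub_le (p : Problem f μ L ℓ 𝒲 w) (X Y : Stack N d) :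
    ‖proj (prodSet N 𝒲) X - proj (prodSet N 𝒲) Y‖ ≤ ‖X - Y‖ :=
  norm_proj_sub_proj_le (nonempty_prodSet p.mem) (isClosed_prodSet p.closed)
    (convex_prodSet p.convex) X Y

theorem continuous_proj (p : Problem f μ L ℓ 𝒲 w) :
    Continuous (proj (prodSet N 𝒲) : Stack N d → Stack N d) :=
  (LipschitzWith.of_dist_le_mul (K := 1) fun X Y => by
    rw [dist_eq_norm, dist_eq_norm, NNReal.coe_one, one_mul]; exact p.proj_sub_le X Y).continuous

theorem continuous_gradient_lyap (p : Problem f μ L ℓ 𝒲 w) (γ η : ℝ) :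
    Continuous (∇ (lyap f ℓ γ η) : Stack N d → Stack N d) := by
  rw [show ∇ (lyap f ℓ γ η) = fun X => gradStack f X + (γ / η) • lapAct ℓ X from
    funext (p.gradient_lyap γ η)]
  have h1 : Continuous (gradStack f : Stack N d → Stack N d) :=
    continuous_gradStack p.L_nonneg p.smooth
  have h2 : Continuous (lapAct ℓ : Stack N d → Stack N d) := continuous_lapAct ℓ
  fun_prop

/-- A gradient step on the Lyapunov function contracts. -/
theorem lyap_step_sub_le (p : Problem f μ L ℓ 𝒲 w) {γ η : ℝ} (hγ : 0 < γ) (hη : 0 < η)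
    (hstep : η * (μ + L) + γ * eig p.lap.symm N ≤ 2) (X Y : Stack N d) :
    ‖(X - η • ∇ (lyap f ℓ γ η) X) - (Y - η • ∇ (lyap f ℓ γ η) Y)‖ ≤ (1 - η * μ) * ‖X - Y‖ := by
  have hβ : 0 < γ / η := div_pos hγ hη
  rw [p.gradient_lyap, p.gradient_lyap]
  refine norm_gradient_step_sub_le (hasGradientAt_lyap p.smooth p.lap.symm γ η)
    (K := L + γ / η * eig p.lap.symm N) ?_
    (lyapGrad_strongMono p.two_le p.conv p.smooth p.lap p.conn hβ)
    (inner_lyapGrad_le p.two_le p.L_nonneg p.smooth p.lap.symm hβ) hη.le ?_ X Y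
  · linarith [p.mu_le, mul_pos hβ p.eig_pos]
  · have : η * (μ + (L + γ / η * eig p.lap.symm N))
        = η * (μ + L) + γ * eig p.lap.symm N := by field_simp; ring
    rw [this]
    exact hstep

theorem step_mul_mu_le_one (p : Problem f μ L ℓ 𝒲 w) {γ η : ℝ} (hγ : 0 < γ) (hη : 0 < η)
    (hstep : η * (μ + L) + γ * eig p.lap.symm N ≤ 2) : η * μ ≤ 1 := by
  have h1 := mul_pos hγ p.eig_pos
  have h2 := mul_le_mul_of_nonneg_left p.mu_le hη.le
  linarith

/-- Under the second smallness condition the unconstrained minimizer of the Lyapunov function is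
feasible, hence equal to `lyapMin`, which therefore is a critical point. -/
theorem lyapMin_spec (p : Problem f μ L ℓ 𝒲 w) {γ η : ℝ} (hγ : 0 < γ) (hη : 0 < η)
    (hsmall : η * (Real.sqrt N * gradDiv f w * L)
      ≤ γ * (Metric.infDist w (frontier 𝒲) * μ * eig p.lap.symm 2)) :
    gradStack f (lyapMin f ℓ 𝒲 γ η) + (γ / η) • lapAct ℓ (lyapMin f ℓ 𝒲 γ η) = 0 ∧
      lyapMin f ℓ 𝒲 γ η ∈ prodSet N 𝒲 := by
  have hβ : 0 < γ / η := div_pos hγ hη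
  obtain ⟨X, hX⟩ := exists_lyapGrad_eq_zero p.two_le p.mu_pos p.mu_le p.conv p.smooth p.lap
    p.conn hβ
  have hb := norm_critical_sub_consensus_le p.two_le p.mu_pos p.mu_le p.conv p.smooth p.lap
    p.conn p.isMin hβ hX
  have hmem : X ∈ prodSet N 𝒲 := by
    refine mem_prodSet_of_norm_sub_le p.closed p.mem (hb.trans ?_)
    have hμ := p.mu_pos
    have hρ := p.conn
    rw [div_mul_eq_mul_div, div_le_iff₀ (by positivity), mul_div_assoc', mul_div_assoc',
      le_div_iff₀ hη]
    linarith
  rw [lyapMin_eq p.two_le p.mu_pos p.conv p.smooth p.lap p.conn hβ hX hmem]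
  exact ⟨hX, hmem⟩

theorem proj_lyap_step_lyapMin (p : Problem f μ L ℓ 𝒲 w) {γ η : ℝ} (hγ : 0 < γ) (hη : 0 < η)
    (hsmall : η * (Real.sqrt N * gradDiv f w * L)
      ≤ γ * (Metric.infDist w (frontier 𝒲) * μ * eig p.lap.symm 2)) :
    proj (prodSet N 𝒲) (lyapMin f ℓ 𝒲 γ η - η • ∇ (lyap f ℓ γ η) (lyapMin f ℓ 𝒲 γ η))
      = lyapMin f ℓ 𝒲 γ η := by
  obtain ⟨h1, h2⟩ := p.lyapMin_spec hγ hη hsmall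
  rw [p.gradient_lyap, h1, smul_zero, sub_zero]
  exact proj_eq_self (nonempty_prodSet p.mem) (isClosed_prodSet p.closed)
    (convex_prodSet p.convex) h2

theorem noiseFree_of_le {γ η : ℕ → ℝ} {κ : ℕ} (X : Stack N d) {k : ℕ} (hk : k ≤ κ) :
    noiseFree f ℓ 𝒲 γ η κ X k = X := by
  cases k with
  | zero => rfl
  | succ k => rw [noiseFree, if_neg (by omega)]

theorem noiseFree_succ {γ η : ℕ → ℝ} {κ : ℕ} (X : Stack N d) {k : ℕ} (hk : κ ≤ k) :
    noiseFree f ℓ 𝒲 γ η κ X (k + 1) = proj (prodSet N 𝒲) (noiseFree f ℓ 𝒲 γ η κ X k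
        - η k • ∇ (lyap f ℓ (γ k) (η k)) (noiseFree f ℓ 𝒲 γ η κ X k)) := by
  rw [noiseFree, if_pos hk]

theorem noiseFree_mem (p : Problem f μ L ℓ 𝒲 w) {γ η : ℕ → ℝ} {κ : ℕ} {X : Stack N d}
    (hX : X ∈ prodSet N 𝒲) (k : ℕ) : noiseFree f ℓ 𝒲 γ η κ X k ∈ prodSet N 𝒲 := by
  cases k with
  | zero => exact hX
  | succ k =>
    rw [noiseFree]
    split_ifs
    · exact p.proj_mem _
    · exact hX

theorem continuous_noiseFree (p : Problem f μ L ℓ 𝒲 w) (γ η : ℕ → ℝ) (κ k : ℕ) :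
    Continuous fun X : Stack N d => noiseFree f ℓ 𝒲 γ η κ X k := by
  induction k with
  | zero => exact continuous_id
  | succ k ih =>
    by_cases hk : κ ≤ k
    · simp only [noiseFree_succ _ hk]
      exact p.continuous_proj.comp (ih.sub
        (((p.continuous_gradient_lyap (γ k) (η k)).comp ih).const_smul (η k)))
    · simp only [noiseFree_of_le _ (by omega : k + 1 ≤ κ)]
      exact continuous_id

section Rates

variable {γ₀ η₀ δ : ℝ} {κ : ℕ}

/-- The penalty bias along the stepsizes. -/
theorem bias_bound (p : Problem f μ L ℓ 𝒲 w) (hγ₀ : 0 < γ₀) (hη₀ : 0 < η₀) (hδ : 0 < δ)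
    (hκ : SmallSteps N μ L (eig p.lap.symm 2) (eig p.lap.symm N)
      (Metric.infDist w (frontier 𝒲)) (gradDiv f w) (consStep γ₀ δ) (learnStep η₀ δ) κ)
    {k : ℕ} (hk : κ ≤ k) :
    1 / Real.sqrt N *
        ‖lyapMin f ℓ 𝒲 (consStep γ₀ δ k) (learnStep η₀ δ k) - consensus N w‖
      ≤ gradDiv f w * L / (μ * eig p.lap.symm 2) * (η₀ / γ₀) * (1 + δ * k) ^ (-(1 / 4) : ℝ) := by
  have hγ := consStep_pos hγ₀ hδ k
  have hη := learnStep_pos hη₀ hδ k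
  have hβ := div_pos hγ hη
  have hNpos : 0 < Real.sqrt N := Real.sqrt_pos.2 (by have := p.two_le; positivity)
  have h := norm_critical_sub_consensus_le p.two_le p.mu_pos p.mu_le p.conv p.smooth p.lap
    p.conn p.isMin hβ (p.lyapMin_spec hγ hη (hκ k hk).2).1
  rw [one_div, inv_mul_le_iff₀ hNpos]
  refine h.trans_eq ?_
  rw [mul_assoc _ (η₀ / γ₀), ← inv_penalty_eq hγ₀ hη₀ hδ]
  have hμ := p.mu_pos
  have hρ := p.conn
  field_simp

/-- The deterministic tracking error along the stepsizes, for every feasible starting point. -/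
theorem tracking_bound (p : Problem f μ L ℓ 𝒲 w) (hγ₀ : 0 < γ₀) (hη₀ : 0 < η₀) (hδ : 0 < δ)
    (hδle : δ ≤ 4 / 5 * μ * η₀)
    (hκ : SmallSteps N μ L (eig p.lap.symm 2) (eig p.lap.symm N)
      (Metric.infDist w (frontier 𝒲)) (gradDiv f w) (consStep γ₀ δ) (learnStep η₀ δ) κ)
    {X : Stack N d} (hX : X ∈ prodSet N 𝒲) {k : ℕ} (hk : κ ≤ k) :
    1 / Real.sqrt N * ‖noiseFree f ℓ 𝒲 (consStep γ₀ δ) (learnStep η₀ δ) κ X k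
        - lyapMin f ℓ 𝒲 (consStep γ₀ δ k) (learnStep η₀ δ k)‖
      ≤ Metric.diam 𝒲 * (1 + δ * ((k : ℝ) - (κ : ℝ)) / (1 + δ * κ)) ^ (-(5 / 4) : ℝ)
        + gradDiv f w * L / (μ * eig p.lap.symm 2) * (η₀ / γ₀) * (Real.exp 1 / 4) *
          (1 + L ^ 2 / (μ * eig p.lap.symm 2) * (η₀ / γ₀) * (1 + δ * k) ^ (-(1 / 4) : ℝ)) *
          (1 + δ * k) ^ (-(1 / 4) : ℝ) := by
  have hμ := p.mu_pos
  have hρ := p.conn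
  have hL := p.L_nonneg
  have hγ := consStep_pos (δ := δ) hγ₀ hδ
  have hη := learnStep_pos (δ := δ) hη₀ hδ
  have hg0 : 0 ≤ gradDiv f w := Real.iSup_nonneg fun i => norm_nonneg _
  have hNpos : 0 < Real.sqrt N := Real.sqrt_pos.2 (by have := p.two_le; positivity)
  refine tracking_recursion (a := μ * η₀) hδ (by linarith) (by positivity) (by positivity)
    Metric.diam_nonneg (κ := κ)
    (p := fun k => 1 / Real.sqrt N * ‖noiseFree f ℓ 𝒲 (consStep γ₀ δ) (learnStep η₀ δ) κ X k
        - lyapMin f ℓ 𝒲 (consStep γ₀ δ k) (learnStep η₀ δ k)‖) ?_ ?_ ?_ k hk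
  · rw [one_div, inv_mul_le_iff₀ hNpos]
    exact norm_sub_le_of_mem_prodSet p.bdd (p.noiseFree_mem hX κ)
      (p.lyapMin_spec (hγ κ) (hη κ) (hκ κ le_rfl).2).2
  · intro k hk
    have := p.step_mul_mu_le_one (hγ k) (hη k) (hκ k hk).1
    rw [learnStep_eq hδ, div_mul_eq_mul_div, div_le_one (by positivity)] at this
    linarith
  · intro k hk
    set Y := noiseFree f ℓ 𝒲 (consStep γ₀ δ) (learnStep η₀ δ) κ X k with hY
    set Z := lyapMin f ℓ 𝒲 (consStep γ₀ δ k) (learnStep η₀ δ k) with hZ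
    set Z' := lyapMin f ℓ 𝒲 (consStep γ₀ δ (k + 1)) (learnStep η₀ δ (k + 1)) with hZ'
    have hcon : ‖noiseFree f ℓ 𝒲 (consStep γ₀ δ) (learnStep η₀ δ) κ X (k + 1) - Z‖
        ≤ (1 - learnStep η₀ δ k * μ) * ‖Y - Z‖ := by
      conv_lhs => rw [noiseFree_succ _ hk, hZ,
        ← p.proj_lyap_step_lyapMin (hγ k) (hη k) (hκ k hk).2]
      exact (p.proj_sub_le _ _).trans (p.lyap_step_sub_le (hγ k) (hη k) (hκ k hk).1 _ _)
    have hdrift := norm_critical_sub_critical_le p.two_le p.mu_pos p.mu_le p.conv p.smooth p.lap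
      p.conn p.isMin (div_pos (hγ k) (hη k)) (penalty_mono hγ₀ hη₀ hδ k)
      (p.lyapMin_spec (hγ k) (hη k) (hκ k hk).2).1
      (p.lyapMin_spec (hγ (k + 1)) (hη (k + 1)) (hκ (k + 1) (by omega)).2).1
    rw [inv_penalty_eq hγ₀ hη₀ hδ, inv_penalty_eq hγ₀ hη₀ hδ, ← hZ, ← hZ'] at hdrift
    have htri := norm_sub_le_norm_sub_add_norm_sub
      (noiseFree f ℓ 𝒲 (consStep γ₀ δ) (learnStep η₀ δ) κ X (k + 1)) Z Z'
    rw [norm_sub_rev Z Z'] at htri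
    have h := htri.trans (add_le_add hcon hdrift)
    have h' := mul_le_mul_of_nonneg_left h (by positivity : 0 ≤ 1 / Real.sqrt N)
    refine h'.trans_eq ?_
    rw [learnStep_eq hδ]
    set τ := (1 + δ * (k : ℝ)) ^ (-(1 / 4) : ℝ)
    set τ' := (1 + δ * ((k + 1 : ℕ) : ℝ)) ^ (-(1 / 4) : ℝ)
    field_simp

end Rates

end Problem

/-! ### The stochastic iterates -/

section Iterates

variable {N d : ℕ} {f : Fin N → Vec d → ℝ} {μ L : ℝ} {ℓ : Matrix (Fin N) (Fin N) ℝ}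
  {𝒲 : Set (Vec d)} {w : Vec d} {Ω : Type*} [mΩ : MeasurableSpace Ω] {P : Measure Ω}
  {ℱ : Filtration ℕ mΩ} {γ η : ℕ → ℝ} {S₁ S₂ : ℝ} {W D G : ℕ → Ω → Stack N d}

theorem IsProcess.mem (hproc : IsProcess P ℱ f ℓ 𝒲 γ η S₁ S₂ W D G)
    (p : Problem f μ L ℓ 𝒲 w) (k : ℕ) (ω : Ω) : W k ω ∈ prodSet N 𝒲 := by
  cases k with
  | zero => exact hproc.init_mem ω
  | succ k => rw [hproc.update]; exact p.proj_mem _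

theorem Problem.memLp_sub [IsProbabilityMeasure P] (p : Problem f μ L ℓ 𝒲 w) {X Y : Ω → Stack N d}
    (hX : StronglyMeasurable X) (hY : StronglyMeasurable Y) (hXm : ∀ ω, X ω ∈ prodSet N 𝒲)
    (hYm : ∀ ω, Y ω ∈ prodSet N 𝒲) : MemLp (fun ω => X ω - Y ω) 2 P :=
  MemLp.of_bound (hX.sub hY).aestronglyMeasurable (Real.sqrt N * Metric.diam 𝒲)
    (ae_of_all _ fun ω => norm_sub_le_of_mem_prodSet p.bdd (hXm ω) (hYm ω))

theorem IsProcess.stronglyMeasurable (hproc : IsProcess P ℱ f ℓ 𝒲 γ η S₁ S₂ W D G) (k : ℕ) :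
    StronglyMeasurable (W k) := (hproc.adapted k).mono (ℱ.le k)

theorem IsProcess.noiseFree_adapted (hproc : IsProcess P ℱ f ℓ 𝒲 γ η S₁ S₂ W D G)
    (p : Problem f μ L ℓ 𝒲 w) {κ k : ℕ} (hk : κ ≤ k) :
    StronglyMeasurable[ℱ k] fun ω => noiseFree f ℓ 𝒲 γ η κ (W κ ω) k :=
  (p.continuous_noiseFree γ η κ k).comp_stronglyMeasurable ((hproc.adapted κ).mono (ℱ.mono hk))

theorem IsProcess.memLp_deviation [IsProbabilityMeasure P]
    (hproc : IsProcess P ℱ f ℓ 𝒲 γ η S₁ S₂ W D G)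
    (p : Problem f μ L ℓ 𝒲 w) {κ k : ℕ} (hk : κ ≤ k) :
    MemLp (fun ω => W k ω - noiseFree f ℓ 𝒲 γ η κ (W κ ω) k) 2 P :=
  p.memLp_sub (hproc.stronglyMeasurable k) ((hproc.noiseFree_adapted p hk).mono (ℱ.le k))
    (hproc.mem p k) fun ω => p.noiseFree_mem (hproc.mem p κ ω) k

/-- Variance recursion: in mean square, one iteration contracts the deviation from the noise-free
dynamics by the factor `1 - η_k μ` and adds the noise of that iteration. -/
theorem IsProcess.deviation_succ_le [IsProbabilityMeasure P]
    (hproc : IsProcess P ℱ f ℓ 𝒲 γ η S₁ S₂ W D G) (p : Problem f μ L ℓ 𝒲 w) {κ k : ℕ}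
    (hk : κ ≤ k) (hγ : 0 < γ k) (hη : 0 < η k)
    (hstep : η k * (μ + L) + γ k * eig p.lap.symm N ≤ 2) :
    1 / (N : ℝ) * ∫ ω, ‖W (k + 1) ω - noiseFree f ℓ 𝒲 γ η κ (W κ ω) (k + 1)‖ ^ 2 ∂P
      ≤ (1 - η k * μ) ^ 2 *
          (1 / (N : ℝ) * ∫ ω, ‖W k ω - noiseFree f ℓ 𝒲 γ η κ (W κ ω) k‖ ^ 2 ∂P)
        + (γ k * Real.sqrt S₁ + η k * Real.sqrt S₂) ^ 2 := by
  have hN : 0 < N := by have := p.two_le; omega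
  have hN' : (0 : ℝ) < N := by exact_mod_cast hN
  set V : Ω → Stack N d := fun ω => noiseFree f ℓ 𝒲 γ η κ (W κ ω) k with hV
  set T : Stack N d → Stack N d := fun X => X - η k • ∇ (lyap f ℓ (γ k) (η k)) X with hT
  have hTc : Continuous T := by
    have := p.continuous_gradient_lyap (γ k) (η k)
    fun_prop
  have hTle : ∀ X Y, ‖T X - T Y‖ ≤ (1 - η k * μ) * ‖X - Y‖ := p.lyap_step_sub_le hγ hη hstep
  have hdev : MemLp (fun ω => W k ω - V ω) 2 P := hproc.memLp_deviation p hk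
  have hXm : StronglyMeasurable[ℱ k] fun ω => T (W k ω) - T (V ω) :=
    (hTc.comp_stronglyMeasurable (hproc.adapted k)).sub
      (hTc.comp_stronglyMeasurable (hproc.noiseFree_adapted p hk))
  have hX : MemLp (fun ω => T (W k ω) - T (V ω)) 2 P :=
    hdev.of_le_mul (hXm.mono (ℱ.le k)).aestronglyMeasurable (ae_of_all _ fun ω => hTle _ _)
  have hV₁ : ∫ ω, ‖D k ω - (P[D k | ℱ k]) ω‖ ^ 2 ∂P ≤ N * S₁ :=
    integral_le_of_condExp_le (ℱ.le k) hN (hproc.variance_D k)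
  have hV₂ : ∫ ω, ‖G k ω - (P[G k | ℱ k]) ω‖ ^ 2 ∂P ≤ N * S₂ := by
    refine le_trans (integral_congr_ae ?_).le
      (integral_le_of_condExp_le (ℱ.le k) hN (hproc.variance_G k))
    filter_upwards [hproc.unbiased_G k] with ω hω
    simp only [hω]
  have hnoisy := integral_norm_noisy_step_le (ℱ.le k) hXm hX (hproc.memLp_D k) (hproc.memLp_G k)
    hγ.le hη.le hV₁ hV₂
  have hint : Integrable (fun ω => ‖T (W k ω) - T (V ω) + (γ k • (D k ω - (P[D k | ℱ k]) ω)
      - η k • (G k ω - (P[G k | ℱ k]) ω))‖ ^ 2) P := by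
    have h1 := ((hproc.memLp_D k).sub ((hproc.memLp_D k).condExp (m := ℱ k) one_le_two)).const_smul
      (γ k)
    have h2 := ((hproc.memLp_G k).sub ((hproc.memLp_G k).condExp (m := ℱ k) one_le_two)).const_smul
      (η k)
    exact (hX.add (h1.sub h2)).integrable_norm_pow two_ne_zero
  have hle : ∫ ω, ‖W (k + 1) ω - noiseFree f ℓ 𝒲 γ η κ (W κ ω) (k + 1)‖ ^ 2 ∂P
      ≤ ∫ ω, ‖T (W k ω) - T (V ω) + (γ k • (D k ω - (P[D k | ℱ k]) ω)
        - η k • (G k ω - (P[G k | ℱ k]) ω))‖ ^ 2 ∂P := by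
    refine integral_mono_ae
      ((hproc.memLp_deviation p (by omega : κ ≤ k + 1)).integrable_norm_pow two_ne_zero) hint ?_
    filter_upwards [hproc.unbiased_D k, hproc.unbiased_G k] with ω hD hG
    refine pow_le_pow_left₀ (norm_nonneg _) ?_ 2
    rw [hproc.update, Problem.noiseFree_succ _ hk, hD, hG]
    refine (p.proj_sub_le _ _).trans_eq (congrArg norm ?_)
    have e : η k • (γ k / η k) • lapAct ℓ (W k ω) = γ k • lapAct ℓ (W k ω) := by
      rw [smul_smul, mul_div_cancel₀ _ hη.ne']
    simp only [hT, hV]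
    rw [p.gradient_lyap _ _ (W k ω), p.gradient_sumObj, smul_add, e]
    module
  have hcontr : ∫ ω, ‖T (W k ω) - T (V ω)‖ ^ 2 ∂P
      ≤ (1 - η k * μ) ^ 2 * ∫ ω, ‖W k ω - V ω‖ ^ 2 ∂P := by
    rw [← integral_const_mul]
    refine integral_mono (hX.integrable_norm_pow two_ne_zero)
      ((hdev.integrable_norm_pow two_ne_zero).const_mul _) fun ω => ?_
    simp only
    rw [← mul_pow]
    exact pow_le_pow_left₀ (norm_nonneg _) (hTle _ _) 2
  have hscale : (γ k * Real.sqrt (N * S₁) + η k * Real.sqrt (N * S₂)) ^ 2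
      = N * (γ k * Real.sqrt S₁ + η k * Real.sqrt S₂) ^ 2 := by
    rw [Real.sqrt_mul hN'.le, Real.sqrt_mul hN'.le]
    have : Real.sqrt (N : ℝ) ^ 2 = N := Real.sq_sqrt hN'.le
    linear_combination (γ k * Real.sqrt S₁ + η k * Real.sqrt S₂) ^ 2 * this
  rw [hscale] at hnoisy
  rw [one_div, inv_mul_le_iff₀ hN']
  have e : (N : ℝ) * ((1 - η k * μ) ^ 2 * ((N : ℝ)⁻¹ * ∫ ω, ‖W k ω - V ω‖ ^ 2 ∂P)
      + (γ k * Real.sqrt S₁ + η k * Real.sqrt S₂) ^ 2)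
      = (1 - η k * μ) ^ 2 * ∫ ω, ‖W k ω - V ω‖ ^ 2 ∂P
        + N * (γ k * Real.sqrt S₁ + η k * Real.sqrt S₂) ^ 2 := by
    field_simp
  rw [e]
  linarith

theorem one_div_sqrt_mul_normE (N : ℕ) {E : Type*} [NormedAddCommGroup E] (X : Ω → E) :
    1 / Real.sqrt N * normE P X = Real.sqrt (1 / (N : ℝ) * ∫ ω, ‖X ω‖ ^ 2 ∂P) := by
  rw [Real.sqrt_mul (by positivity), Real.sqrt_div zero_le_one, Real.sqrt_one, normE]

/-- The deviation from the noise-free dynamics along the decreasing stepsizes. -/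
theorem IsProcess.deviation_bound [IsProbabilityMeasure P] {γ₀ η₀ δ : ℝ} (hγ₀ : 0 < γ₀)
    (hη₀ : 0 < η₀) (hδ : 0 < δ) (hδle : δ ≤ 4 / 5 * μ * η₀)
    (hproc : IsProcess P ℱ f ℓ 𝒲 (consStep γ₀ δ) (learnStep η₀ δ) S₁ S₂ W D G)
    (p : Problem f μ L ℓ 𝒲 w) {κ : ℕ}
    (hκ : SmallSteps N μ L (eig p.lap.symm 2) (eig p.lap.symm N)
      (Metric.infDist w (frontier 𝒲)) (gradDiv f w) (consStep γ₀ δ) (learnStep η₀ δ) κ)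
    {k : ℕ} (hk : κ ≤ k) :
    1 / Real.sqrt N * normE P (fun ω => W k ω
        - noiseFree f ℓ 𝒲 (consStep γ₀ δ) (learnStep η₀ δ) κ (W κ ω) k)
      ≤ Real.sqrt 5 * Real.exp 1 / (2 * Real.sqrt μ) *
          (γ₀ / Real.sqrt η₀ * Real.sqrt S₁
            + Real.sqrt (η₀ * S₂) * (1 + δ * k) ^ (-(1 / 4) : ℝ)) *
          (1 + δ * k) ^ (-(1 / 4) : ℝ) := by
  have hμ := p.mu_pos
  have hγ := consStep_pos (δ := δ) hγ₀ hδ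
  have hη := learnStep_pos (δ := δ) hη₀ hδ
  rw [one_div_sqrt_mul_normE]
  have h := noise_recursion (a := μ * η₀) (p := γ₀ * Real.sqrt S₁) (q := η₀ * Real.sqrt S₂)
    (κ := κ) (v := fun k => 1 / (N : ℝ) * ∫ ω, ‖W k ω
        - noiseFree f ℓ 𝒲 (consStep γ₀ δ) (learnStep η₀ δ) κ (W κ ω) k‖ ^ 2 ∂P)
    hδ (by linarith) (by positivity) (by positivity)
    (by simp [Problem.noiseFree_of_le]) (fun k hk => by
      have := p.step_mul_mu_le_one (hγ k) (hη k) (hκ k hk).1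
      rw [learnStep_eq hδ, div_mul_eq_mul_div, div_le_one (by positivity)] at this
      linarith) (fun k hk => by
      have := hproc.deviation_succ_le p hk (hγ k) (hη k) (hκ k hk).1
      rw [noise_level_eq hδ, learnStep_eq hδ] at this
      rw [mul_comm μ, mul_div_right_comm η₀ μ]
      exact this) k hk
  refine (Real.sqrt_le_sqrt h).trans_eq ?_
  set τ := (1 + δ * (k : ℝ)) ^ (-(1 / 4) : ℝ) with hτ
  have hτ0 : 0 ≤ τ := by positivity
  rw [← Real.sqrt_sq (by positivity : 0 ≤ Real.sqrt 5 * Real.exp 1 / (2 * Real.sqrt μ) *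
    (γ₀ / Real.sqrt η₀ * Real.sqrt S₁ + Real.sqrt (η₀ * S₂) * τ) * τ)]
  congr 1
  have h5 : Real.sqrt 5 ^ 2 = 5 := Real.sq_sqrt (by norm_num)
  have hμs : Real.sqrt μ ^ 2 = μ := Real.sq_sqrt hμ.le
  have hηs : Real.sqrt η₀ ^ 2 = η₀ := Real.sq_sqrt hη₀.le
  have hηp : 0 < Real.sqrt η₀ := Real.sqrt_pos.2 hη₀
  rw [Real.sqrt_mul hη₀.le]
  have e : γ₀ / Real.sqrt η₀ * Real.sqrt S₁ + Real.sqrt η₀ * Real.sqrt S₂ * τ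
      = (γ₀ * Real.sqrt S₁ + η₀ * Real.sqrt S₂ * τ) / Real.sqrt η₀ := by
    nth_rw 3 [← hηs]
    field_simp
  rw [e]
  simp only [mul_pow, div_pow, h5, hμs, hηs]
  field_simp
  ring

/-- The tracking error in root mean square along the decreasing stepsizes. -/
theorem IsProcess.tracking_meanSquare [IsProbabilityMeasure P] {γ₀ η₀ δ : ℝ} (hγ₀ : 0 < γ₀)
    (hη₀ : 0 < η₀) (hδ : 0 < δ) (hδle : δ ≤ 4 / 5 * μ * η₀)
    (hproc : IsProcess P ℱ f ℓ 𝒲 (consStep γ₀ δ) (learnStep η₀ δ) S₁ S₂ W D G)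
    (p : Problem f μ L ℓ 𝒲 w) {κ : ℕ}
    (hκ : SmallSteps N μ L (eig p.lap.symm 2) (eig p.lap.symm N)
      (Metric.infDist w (frontier 𝒲)) (gradDiv f w) (consStep γ₀ δ) (learnStep η₀ δ) κ)
    {k : ℕ} (hk : κ ≤ k) :
    MemLp (fun ω => noiseFree f ℓ 𝒲 (consStep γ₀ δ) (learnStep η₀ δ) κ (W κ ω) k
        - lyapMin f ℓ 𝒲 (consStep γ₀ δ k) (learnStep η₀ δ k)) 2 P ∧
      1 / Real.sqrt N * normE P (fun ω =>
          noiseFree f ℓ 𝒲 (consStep γ₀ δ) (learnStep η₀ δ) κ (W κ ω) k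
            - lyapMin f ℓ 𝒲 (consStep γ₀ δ k) (learnStep η₀ δ k))
        ≤ Metric.diam 𝒲 * (1 + δ * ((k : ℝ) - (κ : ℝ)) / (1 + δ * κ)) ^ (-(5 / 4) : ℝ)
          + gradDiv f w * L / (μ * eig p.lap.symm 2) * (Real.exp 1 / 4) * (η₀ / γ₀) *
            (1 + L ^ 2 / (μ * eig p.lap.symm 2) * (η₀ / γ₀) * (1 + δ * k) ^ (-(1 / 4) : ℝ)) *
            (1 + δ * k) ^ (-(1 / 4) : ℝ) := by
  have hmem := (p.lyapMin_spec (consStep_pos hγ₀ hδ k) (learnStep_pos hη₀ hδ k) (hκ k hk).2).2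
  have hLp := p.memLp_sub (P := P)
    ((hproc.noiseFree_adapted (γ := consStep γ₀ δ) (η := learnStep η₀ δ) p hk).mono (ℱ.le k))
    (stronglyMeasurable_const (b := lyapMin f ℓ 𝒲 (consStep γ₀ δ k) (learnStep η₀ δ k)))
    (fun ω => p.noiseFree_mem (hproc.mem p κ ω) k) fun _ => hmem
  refine ⟨hLp, ?_⟩
  have hNpos : 0 < Real.sqrt N := Real.sqrt_pos.2 (by have := p.two_le; positivity)
  have hb := fun ω => p.tracking_bound hγ₀ hη₀ hδ hδle hκ (hproc.mem p κ ω) hk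
  rw [mul_right_comm _ (Real.exp 1 / 4) (η₀ / γ₀)]
  simp only [one_div, inv_mul_le_iff₀ hNpos] at hb ⊢
  obtain ⟨ω₀⟩ := nonempty_of_isProbabilityMeasure P
  exact normE_le_of_forall_norm_le ((norm_nonneg _).trans (hb ω₀)) hLp hb

theorem IsProcess.memLp_apply_sub [IsProbabilityMeasure P]
    (hproc : IsProcess P ℱ f ℓ 𝒲 γ η S₁ S₂ W D G) (p : Problem f μ L ℓ 𝒲 w) (k : ℕ) (i : Fin N) :
    MemLp (fun ω => W k ω i - w) 2 P := by
  have h := p.memLp_sub (P := P) (hproc.stronglyMeasurable k)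
    (stronglyMeasurable_const (b := consensus N w)) (hproc.mem p k) fun _ _ => p.mem
  refine h.mono ?_ (ae_of_all _ fun ω => norm_apply_le (W k ω - consensus N w) i)
  exact (PiLp.continuous_apply 2 _ i).comp_aestronglyMeasurable h.1

theorem meanSquare_eq (k : ℕ) :
    ∫ ω, 1 / (N : ℝ) * ∑ i, ‖W k ω i - w‖ ^ 2 ∂P
      = (1 / Real.sqrt N * normE P fun ω => W k ω - consensus N w) ^ 2 := by
  rw [one_div_sqrt_mul_normE, Real.sq_sqrt
    (mul_nonneg (by positivity) (integral_nonneg fun ω => by positivity)), integral_const_mul]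
  simp_rw [norm_sq_stack]
  rfl

/-- A root mean square error made of a noise deviation, a tracking error and a bias of the orders
in question is `O((1 + δ k)^{-1/4})`, so its square is `O(1 / √k)`. -/
theorem isBigO_sq_of_rates {δ : ℝ} (hδ : 0 < δ) {κ : ℕ} {e : ℕ → ℝ} (he : ∀ k, 0 ≤ e k)
    {A B C M E F H : ℝ} (hA : 0 ≤ A) (hC : 0 ≤ C) (hM : 0 ≤ M) (hE : 0 ≤ E) (hF : 0 ≤ F)
    (hle : ∀ k : ℕ, κ ≤ k → e k ≤ A * (B + C * (1 + δ * k) ^ (-(1 / 4) : ℝ))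
        * (1 + δ * k) ^ (-(1 / 4) : ℝ)
      + (M * (1 + δ * ((k : ℝ) - (κ : ℝ)) / (1 + δ * κ)) ^ (-(5 / 4) : ℝ)
        + E * (1 + F * (1 + δ * k) ^ (-(1 / 4) : ℝ)) * (1 + δ * k) ^ (-(1 / 4) : ℝ))
      + H * (1 + δ * k) ^ (-(1 / 4) : ℝ)) :
    (fun k => e k ^ 2) =O[atTop] (fun k : ℕ => 1 / Real.sqrt k) := by
  set Q := A * (B + C) + (M * (1 + δ * κ) ^ ((5 : ℝ) / 4) + E * (1 + F)) + H with hQ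
  refine Asymptotics.IsBigO.of_bound (Q ^ 2 / Real.sqrt δ) ?_
  filter_upwards [eventually_ge_atTop κ, eventually_ge_atTop 1] with k hk hk1
  have hk0 : (0 : ℝ) < k := by exact_mod_cast hk1
  have h := hle k hk
  rw [one_add_div_eq hδ] at h
  set t := 1 + δ * (k : ℝ) with ht
  have ht1 : 1 ≤ t := by rw [ht]; linarith [mul_pos hδ hk0]
  have ht0 : 0 < t := by linarith
  set s := 1 + δ * (κ : ℝ)
  have hs : 0 < s := by positivity
  set τ := t ^ (-(1 / 4) : ℝ) with hτ
  have hτ0 : 0 ≤ τ := by positivity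
  have hτ1 : τ ≤ 1 := Real.rpow_le_one_of_one_le_of_nonpos ht1 (by norm_num)
  have hinit : (t / s) ^ (-(5 / 4) : ℝ) ≤ s ^ ((5 : ℝ) / 4) * τ := by
    rw [Real.div_rpow ht0.le hs.le, Real.rpow_neg hs.le, div_inv_eq_mul, mul_comm]
    exact mul_le_mul_of_nonneg_left
      (Real.rpow_le_rpow_of_exponent_le ht1 (by norm_num)) (by positivity)
  have h1 : A * (B + C * τ) * τ ≤ A * (B + C) * τ := by
    gcongr
    exact mul_le_of_le_one_right hC hτ1
  have h2 : E * (1 + F * τ) * τ ≤ E * (1 + F) * τ := by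
    gcongr
    exact mul_le_of_le_one_right hF hτ1
  have h3 := mul_le_mul_of_nonneg_left hinit hM
  have h4 : e k ≤ Q * τ := by rw [hQ]; linarith
  have hτ2 : τ ^ 2 ≤ 1 / (Real.sqrt δ * Real.sqrt k) := by
    have : τ ^ 2 = 1 / Real.sqrt t := by
      rw [hτ, ← Real.rpow_natCast, ← Real.rpow_mul ht0.le, Real.sqrt_eq_rpow,
        one_div (t ^ _), ← Real.rpow_neg ht0.le]
      norm_num
    rw [this, ← Real.sqrt_mul hδ.le]
    refine one_div_le_one_div_of_le (Real.sqrt_pos.2 (by positivity)) (Real.sqrt_le_sqrt ?_)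
    rw [ht]; linarith
  rw [Real.norm_of_nonneg (by positivity), Real.norm_of_nonneg (by positivity)]
  calc e k ^ 2 ≤ (Q * τ) ^ 2 := pow_le_pow_left₀ (he k) h4 2
    _ = Q ^ 2 * τ ^ 2 := by ring
    _ ≤ Q ^ 2 * (1 / (Real.sqrt δ * Real.sqrt k)) := by gcongr
    _ = Q ^ 2 / Real.sqrt δ * (1 / Real.sqrt k) := by field_simp

theorem IsProcess.isBigO_meanSquare [IsProbabilityMeasure P] {γ₀ η₀ δ : ℝ} (hγ₀ : 0 < γ₀)
    (hη₀ : 0 < η₀) (hδ : 0 < δ) (hδle : δ ≤ 4 / 5 * μ * η₀)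
    (hproc : IsProcess P ℱ f ℓ 𝒲 (consStep γ₀ δ) (learnStep η₀ δ) S₁ S₂ W D G)
    (p : Problem f μ L ℓ 𝒲 w) {κ : ℕ}
    (hκ : SmallSteps N μ L (eig p.lap.symm 2) (eig p.lap.symm N)
      (Metric.infDist w (frontier 𝒲)) (gradDiv f w) (consStep γ₀ δ) (learnStep η₀ δ) κ) :
    (fun k : ℕ => ∫ ω, 1 / (N : ℝ) * ∑ i, ‖W k ω i - w‖ ^ 2 ∂P)
      =O[atTop] (fun k : ℕ => 1 / Real.sqrt k) := by
  have hμ := p.mu_pos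
  have hρ := p.conn
  have hL := p.L_nonneg
  have hg0 : 0 ≤ gradDiv f w := Real.iSup_nonneg fun i => norm_nonneg _
  simp_rw [meanSquare_eq]
  refine isBigO_sq_of_rates hδ (κ := κ) (fun k => mul_nonneg (by positivity) (Real.sqrt_nonneg _))
    (by positivity) (by positivity) (Metric.diam_nonneg (s := 𝒲)) (by positivity) (by positivity)
    (fun k hk => ?_)
    (A := Real.sqrt 5 * Real.exp 1 / (2 * Real.sqrt μ)) (B := γ₀ / Real.sqrt η₀ * Real.sqrt S₁)
    (C := Real.sqrt (η₀ * S₂))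
    (E := gradDiv f w * L / (μ * eig p.lap.symm 2) * (Real.exp 1 / 4) * (η₀ / γ₀))
    (F := L ^ 2 / (μ * eig p.lap.symm 2) * (η₀ / γ₀))
    (H := gradDiv f w * L / (μ * eig p.lap.symm 2) * (η₀ / γ₀))
  have h1 := hproc.deviation_bound hγ₀ hη₀ hδ hδle p hκ hk
  obtain ⟨hLp, h2⟩ := hproc.tracking_meanSquare hγ₀ hη₀ hδ hδle p hκ hk
  have h3 := p.bias_bound hγ₀ hη₀ hδ hκ hk
  have hdev := hproc.memLp_deviation p hk
  set b := lyapMin f ℓ 𝒲 (consStep γ₀ δ k) (learnStep η₀ δ k) - consensus N w with hb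
  have hbL : MemLp (fun _ : Ω => b) 2 P := memLp_const b
  have hbE : normE P (fun _ : Ω => b) = ‖b‖ := by simp [normE]
  have h4 := normE_add_le (hdev.add hLp) hbL
  have h5 := normE_add_le hdev hLp
  have h6 := h4.trans (add_le_add h5 hbE.le)
  have hsplit : (fun ω => W k ω - consensus N w) = fun ω =>
      (W k ω - noiseFree f ℓ 𝒲 (consStep γ₀ δ) (learnStep η₀ δ) κ (W κ ω) k)
        + (noiseFree f ℓ 𝒲 (consStep γ₀ δ) (learnStep η₀ δ) κ (W κ ω) k
          - lyapMin f ℓ 𝒲 (consStep γ₀ δ k) (learnStep η₀ δ k)) + b := by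
    funext ω
    rw [hb]
    abel
  rw [hsplit]
  refine (mul_le_mul_of_nonneg_left h6 (by positivity : 0 ≤ 1 / Real.sqrt (N : ℝ))).trans ?_
  rw [mul_add, mul_add]
  exact add_le_add (add_le_add h1 h2) h3

end Iterates
end NoisyDGD

theorem theorem2
    {N d : ℕ} (hN : 2 ≤ N) (hd : 1 ≤ d)
    {Ω : Type*} [mΩ : MeasurableSpace Ω] (P : Measure Ω) [IsProbabilityMeasure P]
    (ℱ : Filtration ℕ mΩ)
    -- local objectives
    (f : Fin N → NoisyDGD.Vec d → ℝ) (μ L : ℝ) (hμ : 0 < μ)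
    (hconv : ∀ i, StrongConvexOn Set.univ μ (f i))
    (hsmooth : ∀ i, NoisyDGD.IsSmooth L (f i))
    -- Laplacian weights of a connected graph
    (ℓ : Matrix (Fin N) (Fin N) ℝ) (hℓ : NoisyDGD.IsLaplacian ℓ)
    (hconn : 0 < NoisyDGD.eig hℓ.symm 2)
    -- constraint set and global optimum
    (𝒲 : Set (NoisyDGD.Vec d)) (hclosed : IsClosed 𝒲) (hconvex : Convex ℝ 𝒲)
    (hbdd : Bornology.IsBounded 𝒲)
    (wstar : NoisyDGD.Vec d) (hmin : IsMinOn (NoisyDGD.avgObj f) Set.univ wstar)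
    (hint : wstar ∈ interior 𝒲)
    -- decreasing stepsizes
    (γ₀ η₀ δ : ℝ) (hγ₀ : 0 < γ₀) (hη₀ : 0 < η₀) (hδ : 0 < δ) (hδle : δ ≤ 4 / 5 * μ * η₀)
    (γ η : ℕ → ℝ) (hγ : γ = NoisyDGD.consStep γ₀ δ) (hη : η = NoisyDGD.learnStep η₀ δ)
    -- the iterates
    (S₁ S₂ : ℝ) (hS₁ : 0 ≤ S₁) (hS₂ : 0 ≤ S₂)
    (W D G : ℕ → Ω → NoisyDGD.Stack N d)
    (hproc : NoisyDGD.IsProcess P ℱ f ℓ 𝒲 γ η S₁ S₂ W D G)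
    -- notation: eigenvalues, distance to the boundary, gradient divergence
    (ρ₂ ρN ζ gradStar : ℝ) (hρ₂ : ρ₂ = NoisyDGD.eig hℓ.symm 2)
    (hρN : ρN = NoisyDGD.eig hℓ.symm N) (hζ : ζ = Metric.infDist wstar (frontier 𝒲))
    (hgrad : gradStar = NoisyDGD.gradDiv f wstar) :
    (∃ κ, NoisyDGD.SmallSteps N μ L ρ₂ ρN ζ gradStar γ η κ) ∧
    (∀ κ, NoisyDGD.SmallSteps N μ L ρ₂ ρN ζ gradStar γ η κ → ∀ k, κ ≤ k →
      -- noise deviation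
      (MemLp (fun ω => W k ω - NoisyDGD.noiseFree f ℓ 𝒲 γ η κ (W κ ω) k) 2 P ∧
        1 / Real.sqrt N *
            NoisyDGD.normE P (fun ω => W k ω - NoisyDGD.noiseFree f ℓ 𝒲 γ η κ (W κ ω) k)
          ≤ Real.sqrt 5 * Real.exp 1 / (2 * Real.sqrt μ) *
              (γ₀ / Real.sqrt η₀ * Real.sqrt S₁
                + Real.sqrt (η₀ * S₂) * (1 + δ * k) ^ (-(1 / 4) : ℝ)) *
              (1 + δ * k) ^ (-(1 / 4) : ℝ)) ∧
      -- tracking error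
      (MemLp (fun ω => NoisyDGD.noiseFree f ℓ 𝒲 γ η κ (W κ ω) k
          - NoisyDGD.lyapMin f ℓ 𝒲 (γ k) (η k)) 2 P ∧
        1 / Real.sqrt N *
            NoisyDGD.normE P (fun ω => NoisyDGD.noiseFree f ℓ 𝒲 γ η κ (W κ ω) k
              - NoisyDGD.lyapMin f ℓ 𝒲 (γ k) (η k))
          ≤ Metric.diam 𝒲 *
              (1 + δ * ((k : ℝ) - (κ : ℝ)) / (1 + δ * κ)) ^ (-(5 / 4) : ℝ)
            + gradStar * L / (μ * ρ₂) * (Real.exp 1 / 4) * (η₀ / γ₀) *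
              (1 + L ^ 2 / (μ * ρ₂) * (η₀ / γ₀) * (1 + δ * k) ^ (-(1 / 4) : ℝ)) *
              (1 + δ * k) ^ (-(1 / 4) : ℝ)) ∧
      -- penalty bias
      1 / Real.sqrt N *
          ‖NoisyDGD.lyapMin f ℓ 𝒲 (γ k) (η k) - NoisyDGD.consensus N wstar‖
        ≤ gradStar * L / (μ * ρ₂) * (η₀ / γ₀) * (1 + δ * k) ^ (-(1 / 4) : ℝ)) ∧
    -- rate of the mean squared distance to the global optimum
    ((∀ k i, MemLp (fun ω => W k ω i - wstar) 2 P) ∧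
      (fun k : ℕ => ∫ ω, 1 / (N : ℝ) * ∑ i, ‖W k ω i - wstar‖ ^ 2 ∂P)
        =O[atTop] (fun k : ℕ => 1 / Real.sqrt k)) := by
  subst hγ hη hρ₂ hρN hζ hgrad
  have p : NoisyDGD.Problem f μ L ℓ 𝒲 wstar :=
    ⟨hN, hd, hμ, hconv, hsmooth, hℓ, hconn, hclosed, hconvex, hbdd, hmin, hint⟩
  have hex := NoisyDGD.exists_smallSteps (L := L) (ρN := NoisyDGD.eig hℓ.symm N) hγ₀ hη₀ hδ N
    (NoisyDGD.gradDiv f wstar) hμ hconn (NoisyDGD.infDist_frontier_pos hd hbdd hint)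
  refine ⟨hex, fun κ hκ k hk => ⟨⟨hproc.memLp_deviation p hk,
      hproc.deviation_bound hγ₀ hη₀ hδ hδle p hκ hk⟩,
    hproc.tracking_meanSquare hγ₀ hη₀ hδ hδle p hκ hk, p.bias_bound hγ₀ hη₀ hδ hκ hk⟩,
    fun k i => hproc.memLp_apply_sub p k i, ?_⟩
  obtain ⟨κ, hκ⟩ := hex
  exact hproc.isBigO_meanSquare hγ₀ hη₀ hδ hδle p hκ
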